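/- **Model and notation.** In the deterministic $\mathsf{LOCAL}$ model a network is a finite simple graph $G$ with $n$ nodes and maximum degree at most $\Delta$, whose nodes have unique identifiers from $\{1,\dots,n^c\}$, where $c\ge 1$ is a constant integer. Initially a node knows $n$, $\Delta$, its identifier, its degree and its private input (if any). In each synchronous round it sends messages of unbounded size to its neighbors, receives their messages and performs an unbounded local computation. An algorithm solves a problem in $R$ rounds if the local outputs of the nodes after $R$ rounds form a correct solution, on every such network and for all admissible inputs. A $(p:q)$-coloring of $G$ assigns to each node $v$ a set $X_v\subseteq\{1,\dots,p\}$ with $|X_v|\ge q$ such that $X_u\cap X_v=\emptyset$ for every edge $\{u,v\}$; its support is $p$, and it is a fractional $x$-coloring if $p/q\le x$. In the $(\mathrm{degree}+1)$-list coloring problem each node $v$ has a list of at least $\deg(v)+1$ arbitrary colors, and a proper coloring that gives each node a color from its list has to be found. Finally, $\log^* n$ is the number of times that $\log_2$ has to be applied to $n$ until the value is at most $1$, and $\log^+x=\max(0,\log x)$. **Theorem.** Let $c,C\ge 1$ be integers. There is a constant $K>0$, depending only on $c$ and $C$, such that the following holds for all integers $n\ge 0$, $\Delta\ge 3$ and $T\ge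 0$ for which some deterministic $\mathsf{LOCAL}$ algorithm solves the $(\mathrm{degree}+1)$-list coloring problem in $T$ rounds on the networks with $n$ nodes and maximum degree at most $\Delta$, when a proper coloring with $C\Delta^2$ colors is given as part of the input. 1. For every integer $q>0$, with $\alpha = 1+\log_\Delta q$, a $(q\Delta : q-1)$-coloring can be computed by a deterministic $\mathsf{LOCAL}$ algorithm in at most $$K\left(\alpha^2\cdot\log\Delta\cdot T+\alpha\cdot\log^* n\right)$$ rounds on the networks with $n$ nodes and maximum degree at most $\Delta$ that, in case $q\ge\Delta+2$, do not contain the complete graph $K_{\Delta+1}$. 2. For every real $0<\varepsilon\le\Delta$ there is an integer $q\ge 2$ with $\Delta/\varepsilon\le q\le K\Delta/\varepsilon$ such that $\frac{q\Delta}{q-1}\le\Delta+\varepsilon$ and $q\Delta\le K\Delta^2/\varepsilon$, and such that a $(q\Delta:q-1)$-coloring, that is, a fractional $(\Delta+\varepsilon)$-coloring with support $O(\Delta^2/\varepsilon)$, can be computed by a deterministic $\mathsf{LOCAL}$ algorithm in at most $$K\left(\left(\log\Delta+\frac{(\log^+(1/\varepsilon))^2}{\log\Delta}\right)\cdot T+\left(1+\frac{\log^+(1/\varepsilon)}{\log\Delta}\right)\cdot\log^*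 n\right)$$ rounds on the networks with $n$ nodes and maximum degree at most $\Delta$ that, in case $\varepsilon<1$, do not contain $K_{\Delta+1}$. -/

import Mathlib

/-- The iterated logarithm `log* n`: how many times `log₂` has to be applied, starting from `n`,
until the value is at most `1`. -/
noncomputable def logStar (n : ℕ) : ℕ :=
  sInf {k : ℕ | (Real.logb 2)^[k] (n : ℝ) ≤ 1}

/-- A deterministic algorithm in the LOCAL model, with a private input from `In` and a local output
in `Out` at every node.  Messages and local computation are unbounded.
Initially a node knows the number `n` of nodes, the degree bound `Δ`, its own identifier, its own
degree and its own input.  In every round it sends a message to each neighbor (possibly different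
messages to different neighbors, addressed by identifier) and updates its state from the messages
received, each of which is labelled with the identifier of its sender. -/
structure LocalAlgorithm (In Out : Type) where
  State : Type
  Msg : Type
  init : (n Δ ident degree : ℕ) → In → State
  send : State → (receiver : ℕ) → Msg
  receive : State → (inbox : ℕ → Option Msg) → State
  output : State → Out

namespace LocalAlgorithm

variable {In Out : Type} (A : LocalAlgorithm In Out) {V : Type} [Fintype V]

open Classical in
/-- The messages that `v` receives when the nodes are in the states `s`: the entry at `i` is the
message of the neighbor of `v` with identifier `i`, if there is one. -/
noncomputable def inbox (G : SimpleGraph V) (ident : V → ℕ) (s : V → A.State) (v : V) :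
    ℕ → Option A.Msg := fun i =>
  if h : ∃ u, G.Adj v u ∧ ident u = i then some (A.send (s h.choose) (ident v)) else none

/-- The states of all nodes after a given number of synchronous rounds. -/
noncomputable def stateAfter (n Δ : ℕ) (G : SimpleGraph V) [DecidableRel G.Adj] (ident : V → ℕ)
    (x : V → In) : ℕ → V → A.State
  | 0 => fun v => A.init n Δ (ident v) (G.degree v) (x v)
  | t + 1 => fun v =>
      A.receive (stateAfter n Δ G ident x t v) (A.inbox G ident (stateAfter n Δ G ident x t) v)

/-- The local outputs after `T` synchronous rounds. -/
noncomputable def run (n Δ : ℕ) (G : SimpleGraph V) [DecidableRel G.Adj] (ident : V → ℕ)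
    (x : V → In) (T : ℕ) (v : V) : Out :=
  A.output (A.stateAfter n Δ G ident x T v)

end LocalAlgorithm

/-- `G` is a network with `n` nodes and maximum degree at most `Δ`, and `ident` assigns to its nodes
unique identifiers from `{1, …, n ^ c}`. -/
structure IsNetwork (c n Δ : ℕ) {V : Type} [Fintype V] (G : SimpleGraph V) [DecidableRel G.Adj]
    (ident : V → ℕ) : Prop where
  card_eq : Fintype.card V = n
  maxDegree_le : G.maxDegree ≤ Δ
  ident_mem : ∀ v, ident v ∈ Finset.Icc 1 (n ^ c)
  ident_injective : Function.Injective ident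

/-- `col` is a proper coloring of `G` with colors from `{1, …, m}`. -/
def IsProperColoring {V : Type} (G : SimpleGraph V) (m : ℕ) (col : V → ℕ) : Prop :=
  (∀ v, col v ∈ Finset.Icc 1 m) ∧ ∀ u v, G.Adj u v → col u ≠ col v

/-- `col` is a proper coloring of `G` in which each node has a color from its list. -/
def IsListColoring {V : Type} (G : SimpleGraph V) (L : V → Finset ℕ) (col : V → ℕ) : Prop :=
  (∀ v, col v ∈ L v) ∧ ∀ u v, G.Adj u v → col u ≠ col v

/-- `X` is a `(p : q)`-coloring of `G`. -/
def IsMulticoloring {V : Type} (G : SimpleGraph V) (p q : ℕ) (X : V → Finset ℕ) : Prop :=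
  (∀ v, X v ⊆ Finset.Icc 1 p) ∧ (∀ v, q ≤ (X v).card) ∧ ∀ u v, G.Adj u v → Disjoint (X u) (X v)

/-- The (degree+1)-list coloring problem, given a proper coloring with `m` colors, is solved by a
deterministic LOCAL algorithm in `T` rounds on all networks with `n` nodes and maximum degree at
most `Δ`.  The input of a node consists of its given color and of its list. -/
def ListColoringInTime (c m n Δ T : ℕ) : Prop :=
  ∃ A : LocalAlgorithm (ℕ × Finset ℕ) ℕ,
    ∀ (V : Type) [Fintype V] (G : SimpleGraph V) [DecidableRel G.Adj] (ident : V → ℕ)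
      (col : V → ℕ) (L : V → Finset ℕ),
      IsNetwork c n Δ G ident → IsProperColoring G m col →
      (∀ v, G.degree v + 1 ≤ (L v).card) →
      IsListColoring G L (A.run n Δ G ident (fun v => (col v, L v)) T)

/-- A `(p : q)`-coloring is computed by a deterministic LOCAL algorithm, without private inputs, in
`R` rounds on all networks with `n` nodes and maximum degree at most `Δ`; if the condition `excl`
holds, then only on those that do not contain the complete graph on `Δ + 1` nodes. -/
def MulticoloringInTime (c n Δ p q : ℕ) (excl : Prop) (R : ℕ) : Prop :=
  ∃ A : LocalAlgorithm Unit (Finset ℕ),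
    ∀ (V : Type) [Fintype V] (G : SimpleGraph V) [DecidableRel G.Adj] (ident : V → ℕ),
      IsNetwork c n Δ G ident → (excl → G.CliqueFree (Δ + 1)) →
      IsMulticoloring G p q (A.run n Δ G ident (fun _ => ()) R)

/-!
The nodes of a ruling set `Z` share out the labels `0, …, q - 1` in the balls around them whose
radius `r` is a constant times `log_Δ q`. A node of `Z` whose ball has fewer than `q` nodes is poor
and does not do so. For every label `i`, a coloring with `Δ` colors of the nodes whose label is not
`i` is found, and the `q` colorings use disjoint blocks of `Δ` colors each. As a node has only one
label, it receives at least `q - 1` colors.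

For a fixed `i`, the nodes with the label `i` and the poor nodes are sinks, and every node has a
sink nearby. Colored greedily in the order of decreasing distance to the sinks, every node which is
not a sink has an uncolored neighbor when its turn comes, so `Δ` colors are enough, and the list
coloring algorithm colors all nodes of the same distance together. The poor nodes remain. The ball
around one of them has fewer than `q` nodes, but if it were impossible to color it by changing
colors only inside the ball, then the uncolored node could be moved to any node of the ball, as in
the proof of Brooks' theorem, and the ball would grow so fast with its radius that it had at least
`q` nodes.
-/

/-! ### Colorings with a hole -/

/-- No proper coloring of `H` with the colors `1, …, Δ` agrees with `φ₀` outside `W`, where `Δ`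
bounds the degrees. This is the situation that the recoloring argument refutes. -/
structure IsRigid {V : Type} (H : SimpleGraph V) (Δ : ℕ) (W : Set V) (φ₀ : V → ℕ) : Prop where
  degree_le : ∀ v, (H.neighborSet v).ncard ≤ Δ
  not_eqOn : ∀ ψ, IsProperColoring H Δ ψ → ¬ Set.EqOn ψ φ₀ Wᶜ

/-- `φ` is a proper coloring, with the colors `1, …, Δ`, of `H` without the node `x ∈ W` (the hole)
that agrees with `φ₀` outside `W`. The value at `x` is irrelevant. -/
structure IsHoleColoring {V : Type} (H : SimpleGraph V) (Δ : ℕ) (W : Set V) (φ₀ : V → ℕ)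
    (x : V) (φ : V → ℕ) : Prop where
  mem : x ∈ W
  mem_Icc : ∀ v, φ v ∈ Finset.Icc 1 Δ
  ne_of_adj : ∀ u v, u ≠ x → v ≠ x → H.Adj u v → φ u ≠ φ v
  eqOn : Set.EqOn φ φ₀ Wᶜ

/-- The path `w` lies in `W` and closes up to a cycle through `x` on which `x` has no chord. -/
structure IsEar {V : Type} (H : SimpleGraph V) (W : Set V) (x : V) {a b : V} (w : H.Walk a b) :
    Prop where
  isPath : w.IsPath
  subset : ∀ v ∈ w.support, v ∈ W
  notMem : x ∉ w.support
  adj_start : H.Adj x a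
  adj_end : H.Adj x b
  chordless : ∀ v ∈ w.support, H.Adj x v → v = a ∨ v = b

/-- Some walk of `H` from `u` to `v` visits only nodes of `S`. -/
def ReachableIn {V : Type} (H : SimpleGraph V) (S : Set V) (u v : V) : Prop :=
  ∃ p : H.Walk u v, ∀ a ∈ p.support, a ∈ S

/-- The nodes of `W` that are neither `x` nor neighbors of `x` other than `y`. A path through these
nodes ending in `y` becomes, together with a further neighbor of `x`, an ear at `x`. -/
def awayFrom {V : Type} (H : SimpleGraph V) (W : Set V) (x y : V) : Set V :=
  {a | a ∈ W ∧ a ≠ x ∧ (H.Adj x a → a = y)}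

namespace ReachableIn

variable {V : Type} {H : SimpleGraph V} {S : Set V} {u v w : V}

theorem refl (hu : u ∈ S) : ReachableIn H S u u :=
  ⟨SimpleGraph.Walk.nil, by simpa using hu⟩

theorem head (h : H.Adj u v) (hu : u ∈ S) (hv : ReachableIn H S v w) : ReachableIn H S u w := by
  obtain ⟨p, hp⟩ := hv
  exact ⟨p.cons h, by simpa using ⟨hu, hp⟩⟩

theorem of_adj (h : H.Adj u v) (hu : u ∈ S) (hv : v ∈ S) : ReachableIn H S u v :=
  (refl hv).head h hu

theorem symm (h : ReachableIn H S u v) : ReachableIn H S v u := by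
  obtain ⟨p, hp⟩ := h
  exact ⟨p.reverse, by simpa using hp⟩

theorem trans (h₁ : ReachableIn H S u v) (h₂ : ReachableIn H S v w) : ReachableIn H S u w := by
  obtain ⟨p, hp⟩ := h₁
  obtain ⟨q, hq⟩ := h₂
  refine ⟨p.append q, fun a ha => ?_⟩
  rcases (p.mem_support_append_iff q).1 ha with ha | ha
  exacts [hp a ha, hq a ha]

end ReachableIn

namespace IsHoleColoring

variable {V : Type} {H : SimpleGraph V} {Δ : ℕ} {W : Set V} {φ₀ φ : V → ℕ} {x : V}

theorem image_neighborSet (hR : IsRigid H Δ W φ₀) (h : IsHoleColoring H Δ W φ₀ x φ) :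
    φ '' H.neighborSet x = ↑(Finset.Icc 1 Δ) := by
  classical
  refine Set.Subset.antisymm (Set.image_subset_iff.2 fun v _ => h.mem_Icc v) fun a ha => ?_
  by_contra hfree
  have hfree' : ∀ v, H.Adj x v → φ v ≠ a := fun v hv e => hfree ⟨v, hv, e⟩
  refine hR.not_eqOn (Function.update φ x a) ⟨fun v => ?_, fun u v huv => ?_⟩ fun v hv => ?_
  · by_cases hv : v = x
    · simpa [hv] using ha
    · simpa [hv] using h.mem_Icc v
  · by_cases hu : u = x
    · subst hu
      simpa [huv.ne'] using (hfree' v huv).symm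
    by_cases hv : v = x
    · subst hv
      simpa [huv.ne] using hfree' u huv.symm
    simpa [hu, hv] using h.ne_of_adj u v hu hv huv
  · rw [Function.update_of_ne (ne_of_mem_of_not_mem h.mem hv).symm, h.eqOn hv]

variable [Finite V]

theorem ncard_neighborSet (hR : IsRigid H Δ W φ₀) (h : IsHoleColoring H Δ W φ₀ x φ) :
    (H.neighborSet x).ncard = Δ := by
  refine le_antisymm (hR.degree_le x) ?_
  simpa [h.image_neighborSet hR, Set.ncard_coe_finset] using
    Set.ncard_image_le (f := φ) (H.neighborSet x).toFinite

theorem injOn_neighborSet (hR : IsRigid H Δ W φ₀) (h : IsHoleColoring H Δ W φ₀ x φ) :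
    Set.InjOn φ (H.neighborSet x) := by
  refine Set.injOn_of_ncard_image_eq ?_ (Set.toFinite _)
  simp [h.image_neighborSet hR, h.ncard_neighborSet hR]

open Classical in
theorem move (hR : IsRigid H Δ W φ₀) (h : IsHoleColoring H Δ W φ₀ x φ) {y : V} (hxy : H.Adj x y)
    (hy : y ∈ W) : IsHoleColoring H Δ W φ₀ y (Function.update φ x (φ y)) where
  mem := hy
  mem_Icc v := by
    by_cases hv : v = x
    · simpa [hv] using h.mem_Icc y
    · simpa [hv] using h.mem_Icc v
  ne_of_adj u v hu hv huv := by
    by_cases hux : u = x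
    · subst hux
      simpa [huv.ne'] using fun e => hv (h.injOn_neighborSet hR hxy huv e).symm
    by_cases hvx : v = x
    · subst hvx
      simpa [huv.ne] using fun e => hu (h.injOn_neighborSet hR huv.symm hxy e)
    simpa [hux, hvx] using h.ne_of_adj u v hux hvx huv
  eqOn v hv := by
    rw [Function.update_of_ne (ne_of_mem_of_not_mem h.mem hv).symm, h.eqOn hv]

theorem slide (hR : IsRigid H Δ W φ₀) (h : IsHoleColoring H Δ W φ₀ x φ) {y : V}
    (w : H.Walk x y) (hw : w.IsPath) (hW : ∀ v ∈ w.support, v ∈ W) :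
    ∃ φ', IsHoleColoring H Δ W φ₀ y φ' ∧
      (∀ i < w.length, φ' (w.getVert i) = φ (w.getVert (i + 1))) ∧
      ∀ v ∉ w.support, φ' v = φ v := by
  classical
  induction w generalizing φ with
  | nil => exact ⟨φ, h, by simp, fun _ _ => rfl⟩
  | @cons x u y hxu w ih =>
    obtain ⟨hw, hx⟩ := (SimpleGraph.Walk.cons_isPath_iff hxu w).1 hw
    have hW' : ∀ v ∈ w.support, v ∈ W := fun v hv => hW v (by simp [hv])
    obtain ⟨φ', h', hshift, hoff⟩ := ih (h.move hR hxu (hW' u w.start_mem_support)) hw hW'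
    refine ⟨φ', h', ?_, fun v hv => ?_⟩
    · rintro (_ | i) hi
      · simp [hoff x hx]
      · have hne : w.getVert (i + 1) ≠ x :=
          ne_of_mem_of_not_mem (w.getVert_mem_support _) hx
        simpa [hne] using hshift i (by simpa using hi)
    · rw [SimpleGraph.Walk.support_cons, List.mem_cons, not_or] at hv
      rw [hoff v hv.2, Function.update_of_ne hv.1]

section Ear

variable {a b : V} {w : H.Walk a b}

theorem rotate (hR : IsRigid H Δ W φ₀) (h : IsHoleColoring H Δ W φ₀ x φ) (hw : IsEar H W x w) :
    ∃ φ', IsHoleColoring H Δ W φ₀ x φ' ∧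
      (∀ i < w.length, φ' (w.getVert i) = φ (w.getVert (i + 1))) ∧ φ' b = φ a ∧
      ∀ v, v ≠ x → v ∉ w.support → φ' v = φ v := by
  classical
  obtain ⟨φ', h', hshift, hoff⟩ := h.slide hR (w.cons hw.adj_start)
    ((SimpleGraph.Walk.cons_isPath_iff _ w).2 ⟨hw.isPath, hw.notMem⟩)
    (by simpa using ⟨h.mem, hw.subset⟩)
  refine ⟨_, h'.move hR hw.adj_end.symm h.mem, fun i hi => ?_, ?_, fun v hvx hv => ?_⟩
  · have hne : w.getVert i ≠ b := fun e =>
      hi.ne ((hw.isPath.getVert_eq_end_iff hi.le).1 e)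
    simpa [hne] using hshift (i + 1) (by simpa using hi)
  · simpa using hshift 0 (by simp)
  · have hne : v ≠ b := fun e => hv (e ▸ w.end_mem_support)
    rw [Function.update_of_ne hne, hoff v (by simp [hvx, hv])]

/-- After a rotation the color of `b` must still occur around the hole, and on the ear only the node
before `b` or `a` itself could carry it. -/
theorem apply_snd_eq_of_isEar (hR : IsRigid H Δ W φ₀) (h : IsHoleColoring H Δ W φ₀ x φ)
    (hw : IsEar H W x w) (hab : a ≠ b) : φ w.snd = φ b := by
  obtain ⟨φ', h', hshift, hend, hoff⟩ := h.rotate hR hw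
  obtain ⟨v, hxv, hvb⟩ : φ b ∈ φ' '' H.neighborSet x := by
    rw [h'.image_neighborSet hR]
    exact h.mem_Icc b
  have hb_ne : ∀ u, H.Adj x u → φ u = φ b → u = b := fun u hu e =>
    h.injOn_neighborSet hR hu hw.adj_end e
  by_cases hv : v ∈ w.support
  · obtain rfl | rfl := hw.chordless v hv hxv
    · have hlen : 0 < w.length := SimpleGraph.Walk.not_nil_iff_lt_length.1 (fun hn => hab hn.eq)
      rw [← hvb]
      simpa using (hshift 0 hlen).symm
    · exact absurd (hb_ne a hw.adj_start (hend.symm.trans hvb)) hab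
  · exact absurd (hb_ne v hxv ((hoff v (H.ne_of_adj hxv).symm hv).symm.trans hvb))
      (fun e => hv (e ▸ w.end_mem_support))

theorem apply_getVert_add_two (hR : IsRigid H Δ W φ₀) (hw : IsEar H W x w) (hab : a ≠ b) (j : ℕ)
    (hj : j + 2 ≤ w.length) (h : IsHoleColoring H Δ W φ₀ x φ) :
    φ (w.getVert (j + 2)) = φ (w.getVert j) := by
  induction j generalizing φ with
  | zero =>
    obtain ⟨φ', h', hshift, hend, -⟩ := h.rotate hR hw
    have hsnd := h'.apply_snd_eq_of_isEar hR hw hab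
    rw [hend, SimpleGraph.Walk.snd, hshift 1 (by omega)] at hsnd
    simpa using hsnd
  | succ j ih =>
    obtain ⟨φ', h', hshift, -⟩ := h.rotate hR hw
    have hφ' := ih (by omega) h'
    rwa [hshift (j + 2) (by omega), hshift j (by omega)] at hφ'

theorem not_even_length_of_isEar (hR : IsRigid H Δ W φ₀) (h : IsHoleColoring H Δ W φ₀ x φ)
    (hw : IsEar H W x w) (hab : a ≠ b) : ¬ Even w.length := by
  intro heven
  have hconst : ∀ i, 2 * i ≤ w.length → φ (w.getVert (2 * i)) = φ a := by
    intro i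
    induction i with
    | zero => simp
    | succ i ih =>
      exact fun hi => (apply_getVert_add_two hR hw hab (2 * i) hi h).trans (ih (by omega))
  obtain ⟨m, hm⟩ := even_iff_two_dvd.1 heven
  have hba : φ b = φ a := by simpa [← hm] using hconst m hm.ge
  exact hab (h.injOn_neighborSet hR hw.adj_start hw.adj_end hba.symm)

end Ear

variable {x₁ y z z' : V}

theorem apply_eq_of_reachableIn (hR : IsRigid H Δ W φ₀) (h : IsHoleColoring H Δ W φ₀ x φ)
    (hx₁ : H.Adj x x₁) (hx₁W : x₁ ∈ W) (hy : H.Adj x y) (hne : x₁ ≠ y) (hz : H.Adj x₁ z)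
    (hr : ReachableIn H (awayFrom H W x y) z y) : φ z = φ y := by
  classical
  obtain ⟨p, hp⟩ := hr
  have hpath : ∀ v ∈ p.bypass.support, v ∈ awayFrom H W x y := fun v hv =>
    hp v (p.support_bypass_subset_support hv)
  have hear : IsEar H W x (p.bypass.cons hz) :=
    { isPath := (SimpleGraph.Walk.cons_isPath_iff _ _).2
        ⟨p.bypass_isPath, fun hmem => hne ((hpath _ hmem).2.2 hx₁)⟩
      subset := by simpa using ⟨hx₁W, fun v hv => (hpath v hv).1⟩
      notMem := by simpa [hx₁.ne] using fun hmem => (hpath x hmem).2.1 rfl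
      adj_start := hx₁
      adj_end := hy
      chordless := by simpa using fun v hv hxv => Or.inr ((hpath v hv).2.2 hxv) }
  simpa using h.apply_snd_eq_of_isEar hR hear hne

theorem eq_of_reachableIn (hR : IsRigid H Δ W φ₀) (h : IsHoleColoring H Δ W φ₀ x φ)
    (hx₁ : H.Adj x x₁) (hx₁W : x₁ ∈ W) (hy : H.Adj x y) (hne : x₁ ≠ y)
    (hz : H.Adj x₁ z) (hzx : z ≠ x) (hr : ReachableIn H (awayFrom H W x y) z y)
    (hz' : H.Adj x₁ z') (hzx' : z' ≠ x) (hr' : ReachableIn H (awayFrom H W x y) z' y) :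
    z = z' := by
  classical
  refine (h.move hR hx₁ hx₁W).injOn_neighborSet hR hz hz' ?_
  rw [Function.update_of_ne hzx, Function.update_of_ne hzx',
    h.apply_eq_of_reachableIn hR hx₁ hx₁W hy hne hz hr,
    h.apply_eq_of_reachableIn hR hx₁ hx₁W hy hne hz' hr']

end IsHoleColoring

/-! ### Growth of the balls in which a hole cannot be filled -/

/-- `v` is a neighbor of `p` on the next level. -/
structure IsChild {V : Type} (H : SimpleGraph V) (lev : V → ℕ) (p v : V) : Prop where
  adj : H.Adj p v
  lev_eq : lev v = lev p + 1

/-- `u` is a neighbor of `v` on the level of `v`. -/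
structure IsSibling {V : Type} (H : SimpleGraph V) (lev : V → ℕ) (v u : V) : Prop where
  adj : H.Adj v u
  lev_eq : lev u = lev v

/-- `lev` behaves up to the value `r` like the distance from `c`. Unlike `SimpleGraph.dist`, it does
not vanish on the nodes that cannot be reached from `c`. -/
structure IsLayering {V : Type} (H : SimpleGraph V) (c : V) (r : ℕ) (lev : V → ℕ) : Prop where
  eq_zero_iff : ∀ v, lev v = 0 ↔ v = c
  le_succ : ∀ u v, H.Adj u v → lev v ≤ lev u + 1
  exists_parent : ∀ v, v ≠ c → lev v ≤ r → ∃ p, IsChild H lev p v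

/-- The coloring `φ₀` with a hole at `c` cannot be repaired by changing colors up to level `r`. -/
structure IsStuck {V : Type} (H : SimpleGraph V) (Δ : ℕ) (φ₀ : V → ℕ) (c : V) (r : ℕ)
    (lev : V → ℕ) : Prop where
  layering : IsLayering H c r lev
  rigid : IsRigid H Δ {v | lev v ≤ r} φ₀
  isHoleColoring : IsHoleColoring H Δ {v | lev v ≤ r} φ₀ c φ₀

theorem IsSibling.symm {V : Type} {H : SimpleGraph V} {lev : V → ℕ} {u v : V}
    (h : IsSibling H lev u v) : IsSibling H lev v u :=
  ⟨h.adj.symm, h.lev_eq.symm⟩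

namespace IsLayering

variable {V : Type} {H : SimpleGraph V} {c : V} {r : ℕ} {lev : V → ℕ}

theorem exists_parent_of_pos (hL : IsLayering H c r lev) {v : V} (hpos : 0 < lev v)
    (hv : lev v ≤ r) : ∃ p, IsChild H lev p v :=
  hL.exists_parent v (fun e => hpos.ne' ((hL.eq_zero_iff v).2 e)) hv

theorem eq_of_lev_eq_zero (hL : IsLayering H c r lev) {u v : V} (hu : lev u = 0)
    (hv : lev v = 0) : u = v :=
  ((hL.eq_zero_iff u).1 hu).trans ((hL.eq_zero_iff v).1 hv).symm

theorem lev_pos_of_isSibling (hL : IsLayering H c r lev) {u v : V} (h : IsSibling H lev v u) :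
    0 < lev v :=
  Nat.pos_of_ne_zero fun h0 => h.adj.ne (hL.eq_of_lev_eq_zero h0 (h.lev_eq.trans h0))

theorem exists_even_path (hL : IsLayering H c r lev) {u v : V} (hu : lev u ≤ r)
    (huv : lev u = lev v) : ∃ w : H.Walk u v, w.IsPath ∧ Even w.length ∧
      ∀ a ∈ w.support, lev a ≤ lev u ∧ (lev a = lev u → a = u ∨ a = v) := by
  induction hk : lev u generalizing u v with
  | zero =>
    obtain rfl := hL.eq_of_lev_eq_zero hk (huv.symm.trans hk)
    exact ⟨SimpleGraph.Walk.nil, by simp, by simp, by simp [hk]⟩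
  | succ k ih =>
    by_cases hne : u = v
    · subst hne
      exact ⟨SimpleGraph.Walk.nil, by simp, by simp, by simp [hk]⟩
    obtain ⟨p, hp⟩ := hL.exists_parent_of_pos (v := u) (by omega) hu
    obtain ⟨q, hq⟩ := hL.exists_parent_of_pos (v := v) (by omega) (by omega)
    have hlp := hp.lev_eq
    have hlq := hq.lev_eq
    obtain ⟨w, hw, heven, hlev⟩ := ih (u := p) (v := q) (by omega) (by omega) (by omega)
    have hnotMem : ∀ a, lev a = k + 1 → a ∉ w.support := fun a ha hmem => by
      have := (hlev a hmem).1
      omega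
    refine ⟨(w.concat hq.adj).cons hp.adj.symm, ?_, ?_, ?_⟩
    · simpa [SimpleGraph.Walk.support_concat, SimpleGraph.Walk.concat_isPath_iff] using
        ⟨⟨hw, hnotMem v (by omega)⟩, hnotMem u hk, hne⟩
    · simpa [Nat.even_add_one] using heven
    · intro a ha
      simp only [SimpleGraph.Walk.support_cons, SimpleGraph.Walk.support_concat, List.mem_cons,
        List.mem_append, List.not_mem_nil, or_false] at ha
      obtain rfl | ha | rfl := ha
      · exact ⟨hk.le, fun _ => Or.inl rfl⟩
      · exact ⟨(hlev a ha).1.trans k.le_succ, fun e => absurd ha (hnotMem a e)⟩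
      · exact ⟨by omega, fun _ => Or.inr rfl⟩

theorem reachableIn_root (hL : IsLayering H c r lev) {x y z : V} (hx : lev x ≤ r)
    (hz : lev z < lev x) (hzy : H.Adj x z → z = y) :
    ReachableIn H (awayFrom H {v | lev v ≤ r} x y) z c := by
  have hmem : ∀ a, lev a < lev x → (H.Adj x a → a = y) → a ∈ awayFrom H {v | lev v ≤ r} x y :=
    fun a ha hay => ⟨ha.le.trans hx, fun e => ha.ne (e ▸ rfl), hay⟩
  induction hk : lev z generalizing z with
  | zero =>
    obtain rfl := (hL.eq_zero_iff z).1 hk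
    exact ReachableIn.refl (hmem z hz hzy)
  | succ k ih =>
    obtain ⟨p, hp⟩ := hL.exists_parent_of_pos (v := z) (by omega) (by omega)
    have hlp := hp.lev_eq
    have hxp : ¬ H.Adj x p := fun h => by have := hL.le_succ _ _ h.symm; omega
    exact (ih (by omega) (fun h => absurd h hxp) (by omega)).head hp.adj.symm (hmem z hz hzy)

theorem reachableIn_of_lt_lev (hL : IsLayering H c r lev) {x y z z' : V} (hx : lev x ≤ r)
    (hz : lev z < lev x) (hzy : H.Adj x z → z = y) (hz' : lev z' < lev x)
    (hzy' : H.Adj x z' → z' = y) :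
    ReachableIn H (awayFrom H {v | lev v ≤ r} x y) z z' :=
  (hL.reachableIn_root hx hz hzy).trans (hL.reachableIn_root hx hz' hzy').symm

end IsLayering

namespace IsStuck

variable {V : Type} {H : SimpleGraph V} {Δ : ℕ} {φ₀ : V → ℕ} {c : V} {r : ℕ} {lev : V → ℕ}

theorem lev_parent_pos (hS : IsStuck H Δ φ₀ c r lev) {p u v : V} (hr : lev v ≤ r)
    (hv : IsChild H lev p v) (hvu : IsSibling H lev v u) (hu : ¬ H.Adj p u) : 0 < lev p := by
  have hlv := hv.lev_eq
  have hlu := hvu.lev_eq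
  obtain ⟨p', hp'⟩ := hS.layering.exists_parent_of_pos (v := u) (by omega) (by omega)
  have hlp' := hp'.lev_eq
  refine Nat.pos_of_ne_zero fun h0 => hu ?_
  exact hS.layering.eq_of_lev_eq_zero (u := p') (v := p) (by omega) h0 ▸ hp'.adj

section Finite

variable [Finite V]

theorem exists_isHoleColoring (hS : IsStuck H Δ φ₀ c r lev) {x : V} (hx : lev x ≤ r) :
    ∃ φ, IsHoleColoring H Δ {v | lev v ≤ r} φ₀ x φ := by
  induction hk : lev x generalizing x with
  | zero => exact ⟨φ₀, (hS.layering.eq_zero_iff x).1 hk ▸ hS.isHoleColoring⟩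
  | succ k ih =>
    obtain ⟨p, hp⟩ := hS.layering.exists_parent_of_pos (v := x) (by omega) hx
    have hlp := hp.lev_eq
    obtain ⟨φ, hφ⟩ := ih (x := p) (by omega) (by omega)
    exact ⟨_, hφ.move hS.rigid hp.adj hx⟩

theorem eq_of_reachableIn (hS : IsStuck H Δ φ₀ c r lev) {x x₁ y z z' : V} (hx : lev x ≤ r)
    (hx₁ : H.Adj x x₁) (hx₁r : lev x₁ ≤ r) (hy : H.Adj x y) (hne : x₁ ≠ y)
    (hz : H.Adj x₁ z) (hzx : z ≠ x)
    (hr : ReachableIn H (awayFrom H {v | lev v ≤ r} x y) z y)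
    (hz' : H.Adj x₁ z') (hzx' : z' ≠ x)
    (hr' : ReachableIn H (awayFrom H {v | lev v ≤ r} x y) z' y) : z = z' := by
  obtain ⟨φ, hφ⟩ := hS.exists_isHoleColoring hx
  exact hφ.eq_of_reachableIn hS.rigid hx₁ hx₁r hy hne hz hzx hr hz' hzx' hr'

theorem parent_unique (hS : IsStuck H Δ φ₀ c r lev) {p q v : V} (hv : lev v ≤ r)
    (hp : IsChild H lev p v) (hq : IsChild H lev q v) : p = q := by
  by_contra hne
  have hlp := hp.lev_eq
  have hlq := hq.lev_eq
  obtain ⟨w, hw, heven, hlev⟩ := hS.layering.exists_even_path (u := p) (v := q) (by omega)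
    (by omega)
  have hear : IsEar H {v | lev v ≤ r} v w :=
    { isPath := hw
      subset := fun a ha => (hlev a ha).1.trans (by omega)
      notMem := fun hmem => by have := (hlev v hmem).1; omega
      adj_start := hp.adj.symm
      adj_end := hq.adj.symm
      chordless := fun a ha hva => (hlev a ha).2 <| by
        have := hS.layering.le_succ _ _ hva.symm
        have := (hlev a ha).1
        omega }
  obtain ⟨φ, hφ⟩ := hS.exists_isHoleColoring hv
  exact hφ.not_even_length_of_isEar hS.rigid hear hne heven

theorem adj_of_isSibling (hS : IsStuck H Δ φ₀ c r lev) {p u v w : V} (hr : lev v ≤ r)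
    (hv : IsChild H lev p v) (hu : IsChild H lev p u) (hvu : IsSibling H lev v u)
    (hvw : IsSibling H lev v w) (hne : w ≠ u) : H.Adj w u := by
  by_contra hwu
  have hL := hS.layering
  have hlv := hv.lev_eq
  have hlu := hvu.lev_eq
  have hlw := hvw.lev_eq
  have hw_away : w ∈ awayFrom H {v | lev v ≤ r} u p :=
    ⟨hlw.le.trans hr, hne, fun h => absurd h.symm hwu⟩
  obtain ⟨p', hp'⟩ := hL.exists_parent_of_pos (v := w) (by omega) (by omega)
  have hlp' := hp'.lev_eq
  have hp'p : H.Adj u p' → p' = p := fun h =>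
    hS.parent_unique (by omega) ⟨h.symm, by omega⟩ hu
  have hreach : ReachableIn H (awayFrom H {v | lev v ≤ r} u p) w p :=
    (hL.reachableIn_of_lt_lev (by omega) (by omega) hp'p (by omega) fun _ => rfl).head
      hp'.adj.symm hw_away
  have hpr : p ∈ awayFrom H {v | lev v ≤ r} u p :=
    ⟨show lev p ≤ r by omega, hu.adj.ne, fun _ => rfl⟩
  have hpw : p = w := hS.eq_of_reachableIn (by omega) hvu.adj.symm hr hu.adj.symm hv.adj.ne'
    hv.adj.symm hu.adj.ne (ReachableIn.refl hpr) hvw.adj hne hreach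
  subst hpw
  omega

theorem isChild_of_isSibling (hS : IsStuck H Δ φ₀ c r lev) {p u v w : V} (hr : lev v ≤ r)
    (hv : IsChild H lev p v) (hu : IsChild H lev p u) (hvu : IsSibling H lev v u)
    (hvw : IsSibling H lev v w) : IsChild H lev p w := by
  have hlv := hv.lev_eq
  have hlu := hvu.lev_eq
  have hlw := hvw.lev_eq
  by_cases hne : w = u
  · exact hne ▸ hu
  refine ⟨?_, by omega⟩
  by_contra hpw
  have hwu := hS.adj_of_isSibling hr hv hu hvu hvw hne
  have hwp : w ≠ p := fun e => by subst e; omega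
  have hv_away : v ∈ awayFrom H {v | lev v ≤ r} p v := ⟨hr, hv.adj.ne', fun _ => rfl⟩
  have hw_away : w ∈ awayFrom H {v | lev v ≤ r} p v :=
    ⟨hlw.le.trans hr, hwp, fun h => absurd h hpw⟩
  exact hvw.adj.ne <| hS.eq_of_reachableIn (by omega) hu.adj (by omega) hv.adj hvu.adj.ne'
    hvu.adj.symm hv.adj.ne' (ReachableIn.refl hv_away) hwu.symm hwp
    (ReachableIn.of_adj hvw.adj.symm hw_away hv_away)

theorem not_isSibling_parent (hS : IsStuck H Δ φ₀ c r lev) {p u v w : V} (hr : lev v ≤ r)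
    (hv : IsChild H lev p v) (hvu : IsSibling H lev v u) (hu : ¬ H.Adj p u) :
    ¬ IsSibling H lev p w := by
  intro hpw
  have hL := hS.layering
  have hlv := hv.lev_eq
  have hlu := hvu.lev_eq
  have hlw := hpw.lev_eq
  have hp0 := hL.lev_pos_of_isSibling hpw
  obtain ⟨g, hg⟩ := hL.exists_parent_of_pos (v := p) hp0 (by omega)
  obtain ⟨p', hp'⟩ := hL.exists_parent_of_pos (v := u) (by omega) (by omega)
  have hlg := hg.lev_eq
  have hlp' := hp'.lev_eq
  have hvp' : ¬ H.Adj v p' := fun h =>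
    hu (hS.parent_unique hr hv ⟨h.symm, by omega⟩ ▸ hp'.adj)
  have hvw : ¬ H.Adj v w := fun h =>
    hpw.adj.ne (hS.parent_unique hr hv ⟨h.symm, by omega⟩)
  have hvg : ¬ H.Adj v g := fun h => by have := hL.le_succ _ _ h.symm; omega
  have hu_away : u ∈ awayFrom H {v | lev v ≤ r} v u :=
    ⟨hlu.le.trans hr, hvu.adj.ne', fun _ => rfl⟩
  have hp'_away : p' ∈ awayFrom H {v | lev v ≤ r} v u :=
    ⟨show lev p' ≤ r by omega, fun e => by subst e; omega, fun h => absurd h hvp'⟩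
  have hreach : ∀ z, lev z < lev v → ¬ H.Adj v z →
      ReachableIn H (awayFrom H {v | lev v ≤ r} v u) z u := fun z hz hvz =>
    (hL.reachableIn_of_lt_lev hr hz (fun h => absurd h hvz) (by omega)
      fun h => absurd h hvp').trans (ReachableIn.of_adj hp'.adj hp'_away hu_away)
  have hgw : g = w := hS.eq_of_reachableIn hr hv.adj.symm (by omega) hvu.adj
    (fun e => by subst e; omega) hg.adj.symm (fun e => by subst e; omega)
    (hreach g (by omega) hvg) hpw.adj (fun e => by subst e; omega) (hreach w (by omega) hvw)
  subst hgw
  omega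

theorem reachableIn_grandparent (hS : IsStuck H Δ φ₀ c r lev) {g p u v : V} (hr : lev v ≤ r)
    (hp : IsChild H lev g p) (hv : IsChild H lev p v) (hvu : IsSibling H lev v u)
    (hu : ¬ H.Adj p u) : ReachableIn H (awayFrom H {v | lev v ≤ r} p g) u g := by
  have hL := hS.layering
  have hlp := hp.lev_eq
  have hlv := hv.lev_eq
  have hlu := hvu.lev_eq
  obtain ⟨p', hp'⟩ := hL.exists_parent_of_pos (v := u) (by omega) (by omega)
  have hlp' := hp'.lev_eq
  obtain ⟨g', hg'⟩ := hL.exists_parent_of_pos (v := p') (by omega) (by omega)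
  have hlg' := hg'.lev_eq
  have hpp' : ¬ H.Adj p p' := fun h =>
    hS.not_isSibling_parent hr hv hvu hu ⟨h, by omega⟩
  have hg'g : H.Adj p g' → g' = g := fun h =>
    hS.parent_unique (by omega) ⟨h.symm, by omega⟩ hp
  have hu_away : u ∈ awayFrom H {v | lev v ≤ r} p g :=
    ⟨hlu.le.trans hr, fun e => by subst e; omega, fun h => absurd h hu⟩
  have hp'_away : p' ∈ awayFrom H {v | lev v ≤ r} p g :=
    ⟨show lev p' ≤ r by omega, fun e => hu (e ▸ hp'.adj), fun h => absurd h hpp'⟩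
  have hreach : ReachableIn H (awayFrom H {v | lev v ≤ r} p g) g' g :=
    hL.reachableIn_of_lt_lev (by omega) (by omega) hg'g (by omega) fun _ => rfl
  exact (hreach.head hg'.adj.symm hp'_away).head hp'.adj.symm hu_away

theorem isSibling_unique_of_not_adj (hS : IsStuck H Δ φ₀ c r lev) {p u v w : V} (hr : lev v ≤ r)
    (hv : IsChild H lev p v) (hvu : IsSibling H lev v u) (hu : ¬ H.Adj p u)
    (hvw : IsSibling H lev v w) (hw : ¬ H.Adj p w) : u = w := by
  have hlv := hv.lev_eq
  have hlu := hvu.lev_eq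
  have hlw := hvw.lev_eq
  obtain ⟨g, hg⟩ := hS.layering.exists_parent_of_pos (hS.lev_parent_pos hr hv hvu hu) (by omega)
  have hlg := hg.lev_eq
  exact hS.eq_of_reachableIn (by omega) hv.adj hr hg.adj.symm (fun e => by subst e; omega)
    hvu.adj (fun e => by subst e; omega) (hS.reachableIn_grandparent hr hg hv hvu hu)
    hvw.adj (fun e => by subst e; omega) (hS.reachableIn_grandparent hr hg hv hvw hw)

end Finite

end IsStuck

section Growth

variable {V : Type} [Fintype V] {H : SimpleGraph V} {Δ : ℕ} {φ₀ : V → ℕ} {c : V} {r : ℕ}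
  {lev : V → ℕ}

open Classical in
/-- The children of `p`, as a finite set. -/
noncomputable def childSet (H : SimpleGraph V) (lev : V → ℕ) (p : V) : Finset V :=
  Finset.univ.filter (IsChild H lev p)

open Classical in
/-- The siblings of `v`, as a finite set; `v` itself does not belong to it. -/
noncomputable def siblingSet (H : SimpleGraph V) (lev : V → ℕ) (v : V) : Finset V :=
  Finset.univ.filter (IsSibling H lev v)

/-- The nodes on the level `k`. -/
def levelSet (lev : V → ℕ) (k : ℕ) : Finset V :=
  Finset.univ.filter fun v => lev v = k

@[simp]
theorem mem_childSet {p v : V} : v ∈ childSet H lev p ↔ IsChild H lev p v := by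
  simp [childSet]

@[simp]
theorem mem_siblingSet {u v : V} : u ∈ siblingSet H lev v ↔ IsSibling H lev v u := by
  simp [siblingSet]

@[simp]
theorem mem_levelSet {k : ℕ} {v : V} : v ∈ levelSet lev k ↔ lev v = k := by
  simp [levelSet]

theorem notMem_siblingSet_self (v : V) : v ∉ siblingSet H lev v := fun h =>
  (mem_siblingSet.1 h).adj.ne rfl

namespace IsStuck

theorem le_card_siblingSet_add_card_childSet (hS : IsStuck H Δ φ₀ c r lev) {v : V}
    (hv : lev v ≤ r) : Δ ≤ 1 + (siblingSet H lev v).card + (childSet H lev v).card := by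
  classical
  obtain ⟨φ, hφ⟩ := hS.exists_isHoleColoring hv
  have hL := hS.layering
  obtain ⟨p, hp⟩ : ∃ p, ∀ u, IsChild H lev u v → u = p := by
    by_cases hex : ∃ p, IsChild H lev p v
    · exact hex.imp fun p hp u hu => hS.parent_unique hv hu hp
    · exact ⟨v, fun u hu => absurd ⟨u, hu⟩ hex⟩
  have hsub : H.neighborSet v ⊆ ↑({p} ∪ siblingSet H lev v ∪ childSet H lev v : Finset V) := by
    intro u (hu : H.Adj v u)
    have hvu := hL.le_succ _ _ hu
    have huv := hL.le_succ _ _ hu.symm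
    simp only [Finset.coe_union, Finset.coe_singleton, Set.mem_union, Set.mem_singleton_iff,
      Finset.mem_coe, mem_siblingSet, mem_childSet]
    obtain h | h | h := lt_trichotomy (lev u) (lev v)
    · exact Or.inl (Or.inl (hp u ⟨hu.symm, by omega⟩))
    · exact Or.inl (Or.inr ⟨hu, h⟩)
    · exact Or.inr ⟨hu, by omega⟩
  calc Δ = (H.neighborSet v).ncard := (hφ.ncard_neighborSet hS.rigid).symm
    _ ≤ ({p} ∪ siblingSet H lev v ∪ childSet H lev v).card :=
      (Set.ncard_le_ncard hsub (Set.toFinite _)).trans_eq (Set.ncard_coe_finset _)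
    _ ≤ ({p} ∪ siblingSet H lev v).card + (childSet H lev v).card := Finset.card_union_le _ _
    _ ≤ 1 + (siblingSet H lev v).card + (childSet H lev v).card :=
      Nat.add_le_add_right (Finset.card_union_le _ _) _

section Family

variable [DecidableEq V] {p u v : V}

theorem isChild_of_mem_insert_siblingSet (hS : IsStuck H Δ φ₀ c r lev) (hr : lev v ≤ r)
    (hv : IsChild H lev p v) (hu : IsChild H lev p u) (hvu : IsSibling H lev v u) {w : V}
    (hw : w ∈ insert v (siblingSet H lev v)) : IsChild H lev p w := by
  obtain rfl | hw := Finset.mem_insert.1 hw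
  · exact hv
  · exact hS.isChild_of_isSibling hr hv hu hvu (mem_siblingSet.1 hw)

theorem isClique_insert_siblingSet (hS : IsStuck H Δ φ₀ c r lev) (hr : lev v ≤ r)
    (hv : IsChild H lev p v) (hu : IsChild H lev p u) (hvu : IsSibling H lev v u) :
    H.IsClique (insert v (siblingSet H lev v) : Finset V) := by
  rw [Finset.coe_insert]
  refine SimpleGraph.IsClique.insert (fun a ha b hb hne => ?_)
    fun b hb _ => (mem_siblingSet.1 hb).adj
  have hb' := mem_siblingSet.1 hb
  exact hS.adj_of_isSibling hr hv (hS.isChild_of_isSibling hr hv hu hvu hb') hb'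
    (mem_siblingSet.1 ha) hne

theorem siblingSet_subset_erase (hS : IsStuck H Δ φ₀ c r lev) (hr : lev v ≤ r)
    (hv : IsChild H lev p v) (hu : IsChild H lev p u) (hvu : IsSibling H lev v u) {w : V}
    (hw : w ∈ insert v (siblingSet H lev v)) :
    siblingSet H lev w ⊆ (insert v (siblingSet H lev v)).erase w := by
  intro x hx
  have hwx := mem_siblingSet.1 hx
  refine Finset.mem_erase.2 ⟨hwx.adj.ne', Finset.mem_insert.2 ?_⟩
  obtain rfl | hw' := Finset.mem_insert.1 hw
  · exact Or.inr hx
  refine or_iff_not_imp_left.2 fun hxv => mem_siblingSet.2 ?_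
  have hvw := mem_siblingSet.1 hw'
  have hpw := hS.isChild_of_isSibling hr hv hu hvu hvw
  exact ⟨(hS.adj_of_isSibling (hvw.lev_eq.le.trans hr) hpw hv hvw.symm hwx hxv).symm,
    hwx.lev_eq.trans hvw.lev_eq⟩

end Family

theorem card_siblingSet_add_two_le (hS : IsStuck H Δ φ₀ c r lev) (hΔ : 3 ≤ Δ)
    (hfree : H.CliqueFree (Δ + 1)) {v : V} (hr : lev v ≤ r) :
    (siblingSet H lev v).card + 2 ≤ Δ := by
  classical
  obtain h0 | hpos := (lev v).eq_zero_or_pos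
  · have hempty : siblingSet H lev v = ∅ := Finset.eq_empty_of_forall_notMem fun w hw =>
      (hS.layering.lev_pos_of_isSibling (mem_siblingSet.1 hw)).ne' h0
    simp only [hempty, Finset.card_empty]
    omega
  obtain ⟨p, hp⟩ := hS.layering.exists_parent_of_pos hpos hr
  by_cases hchild : ∃ u, IsSibling H lev v u ∧ IsChild H lev p u
  · obtain ⟨u, hvu, hu⟩ := hchild
    have hclique : H.IsNClique ((siblingSet H lev v).card + 1 + 1)
        (insert p (insert v (siblingSet H lev v))) :=
      SimpleGraph.IsNClique.insert
        ⟨hS.isClique_insert_siblingSet hr hp hu hvu,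
          Finset.card_insert_of_notMem (notMem_siblingSet_self v)⟩
        fun b hb => (hS.isChild_of_mem_insert_siblingSet hr hp hu hvu hb).adj
    by_contra hlt
    exact hfree.mono (by omega) _ hclique
  · have hnot : ∀ u ∈ siblingSet H lev v, ¬ H.Adj p u := fun u hu hpu =>
      have hvu := mem_siblingSet.1 hu
      hchild ⟨u, hvu, hpu, hvu.lev_eq.trans hp.lev_eq⟩
    have hone : (siblingSet H lev v).card ≤ 1 := Finset.card_le_one.2 fun a ha b hb =>
      hS.isSibling_unique_of_not_adj hr hp (mem_siblingSet.1 ha) (hnot a ha)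
        (mem_siblingSet.1 hb) (hnot b hb)
    omega

theorem card_childSet_pos (hS : IsStuck H Δ φ₀ c r lev) (hΔ : 3 ≤ Δ)
    (hfree : H.CliqueFree (Δ + 1)) {v : V} (hr : lev v ≤ r) : 0 < (childSet H lev v).card := by
  have := hS.le_card_siblingSet_add_card_childSet hr
  have := hS.card_siblingSet_add_two_le hΔ hfree hr
  omega

theorem le_card_childSet_of_siblingSet_eq_empty (hS : IsStuck H Δ φ₀ c r lev) {v : V}
    (hr : lev v ≤ r) (hv : siblingSet H lev v = ∅) : Δ - 1 ≤ (childSet H lev v).card := by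
  have := hS.le_card_siblingSet_add_card_childSet hr
  simp only [hv, Finset.card_empty] at this
  omega

/-- A clique of `k` children of `p` that contains all siblings of its members has at least
`k * (Δ - k) ≥ Δ - 1` children. -/
theorem le_sum_card_childSet_of_isSibling (hS : IsStuck H Δ φ₀ c r lev) (hΔ : 3 ≤ Δ)
    (hfree : H.CliqueFree (Δ + 1)) {p u v : V} (hr : lev v ≤ r) (hv : IsChild H lev p v)
    (hu : IsChild H lev p u) (hvu : IsSibling H lev v u) :
    Δ - 1 ≤ ∑ w ∈ childSet H lev p, (childSet H lev w).card := by
  classical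
  set S := insert v (siblingSet H lev v)
  have hcard : S.card = (siblingSet H lev v).card + 1 :=
    Finset.card_insert_of_notMem (notMem_siblingSet_self v)
  have hle := hS.card_siblingSet_add_two_le hΔ hfree hr
  have hchild : ∀ w ∈ S, IsChild H lev p w := fun w hw =>
    hS.isChild_of_mem_insert_siblingSet hr hv hu hvu hw
  have hmany : ∀ w ∈ S, Δ - S.card ≤ (childSet H lev w).card := fun w hw => by
    have hdeg := hS.le_card_siblingSet_add_card_childSet
      (((hchild w hw).lev_eq.trans hv.lev_eq.symm).le.trans hr)
    have hsib := Finset.card_le_card (hS.siblingSet_subset_erase hr hv hu hvu hw)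
    rw [Finset.card_erase_of_mem hw] at hsib
    omega
  calc Δ - 1 ≤ S.card * (Δ - S.card) := by
        obtain ⟨b, hb⟩ : ∃ b, Δ = S.card + b + 1 := ⟨Δ - S.card - 1, by omega⟩
        rw [hb, hcard, show ∀ a, a + 1 + b + 1 - (a + 1) = b + 1 by omega]
        grind
    _ = ∑ _w ∈ S, (Δ - S.card) := by rw [Finset.sum_const, smul_eq_mul]
    _ ≤ ∑ w ∈ S, (childSet H lev w).card := Finset.sum_le_sum hmany
    _ ≤ ∑ w ∈ childSet H lev p, (childSet H lev w).card :=
      Finset.sum_le_sum_of_subset fun w hw => mem_childSet.2 (hchild w hw)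

theorem le_sum_card_childSet (hS : IsStuck H Δ φ₀ c r lev) (hΔ : 3 ≤ Δ)
    (hfree : H.CliqueFree (Δ + 1)) {p : V} (hp : lev p + 2 ≤ r) :
    Δ - 1 ≤ ∑ v ∈ childSet H lev p, (childSet H lev v).card := by
  have hlev : ∀ {v}, IsChild H lev p v → lev v ≤ r := fun hv => by
    have := hv.lev_eq
    omega
  by_cases hlone : ∃ v, IsChild H lev p v ∧ siblingSet H lev v = ∅
  · obtain ⟨v, hv, hempty⟩ := hlone
    exact (hS.le_card_childSet_of_siblingSet_eq_empty (hlev hv) hempty).trans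
      (Finset.single_le_sum (f := fun v => (childSet H lev v).card) (fun _ _ => Nat.zero_le _)
        (mem_childSet.2 hv))
  obtain ⟨v, hv⟩ := Finset.card_pos.1 (hS.card_childSet_pos hΔ hfree (v := p) (by omega))
  rw [mem_childSet] at hv
  obtain ⟨u, hu⟩ := Finset.nonempty_iff_ne_empty.2 fun hempty => hlone ⟨v, hv, hempty⟩
  rw [mem_siblingSet] at hu
  by_cases hpu : H.Adj p u
  · exact hS.le_sum_card_childSet_of_isSibling hΔ hfree (hlev hv) hv
      ⟨hpu, hu.lev_eq.trans hv.lev_eq⟩ hu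
  have hempty : siblingSet H lev p = ∅ := Finset.eq_empty_of_forall_notMem fun w hw =>
    hS.not_isSibling_parent (hlev hv) hv hu hpu (mem_siblingSet.1 hw)
  calc Δ - 1 ≤ (childSet H lev p).card :=
        hS.le_card_childSet_of_siblingSet_eq_empty (by omega) hempty
    _ = ∑ _v ∈ childSet H lev p, 1 := Finset.card_eq_sum_ones _
    _ ≤ ∑ v ∈ childSet H lev p, (childSet H lev v).card :=
      Finset.sum_le_sum fun w hw => hS.card_childSet_pos hΔ hfree (hlev (mem_childSet.1 hw))

theorem sum_childSet_le (hS : IsStuck H Δ φ₀ c r lev) {k : ℕ} (hk : k + 1 ≤ r) (f : V → ℕ) :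
    ∑ p ∈ levelSet lev k, ∑ v ∈ childSet H lev p, f v ≤ ∑ v ∈ levelSet lev (k + 1), f v := by
  classical
  have hlev : ∀ {p v}, p ∈ levelSet lev k → v ∈ childSet H lev p → lev v = k + 1 :=
    fun hp hv => mem_levelSet.1 hp ▸ (mem_childSet.1 hv).lev_eq
  have hdisj : (levelSet lev k : Set V).PairwiseDisjoint (childSet H lev) :=
    fun p hp q _ hne => Finset.disjoint_left.2 fun v hvp hvq =>
      hne (hS.parent_unique ((hlev hp hvp).trans_le hk) (mem_childSet.1 hvp)
        (mem_childSet.1 hvq))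
  rw [← Finset.sum_biUnion hdisj]
  refine Finset.sum_le_sum_of_subset fun v hv => ?_
  obtain ⟨p, hp, hpv⟩ := Finset.mem_biUnion.1 hv
  exact mem_levelSet.2 (hlev hp hpv)

theorem pow_le_card_levelSet (hS : IsStuck H Δ φ₀ c r lev) (hΔ : 3 ≤ Δ)
    (hfree : H.CliqueFree (Δ + 1)) {j : ℕ} (hj : 2 * j ≤ r) :
    (Δ - 1) ^ j ≤ (levelSet lev (2 * j)).card := by
  induction j with
  | zero =>
    exact Finset.card_pos.2 ⟨c, mem_levelSet.2 ((hS.layering.eq_zero_iff c).2 rfl)⟩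
  | succ j ih =>
    calc (Δ - 1) ^ (j + 1) = (Δ - 1) ^ j * (Δ - 1) := pow_succ _ _
      _ ≤ (levelSet lev (2 * j)).card * (Δ - 1) := Nat.mul_le_mul_right _ (ih (by omega))
      _ = ∑ _p ∈ levelSet lev (2 * j), (Δ - 1) := by rw [Finset.sum_const, smul_eq_mul]
      _ ≤ ∑ p ∈ levelSet lev (2 * j), ∑ v ∈ childSet H lev p, (childSet H lev v).card :=
        Finset.sum_le_sum fun p hp => hS.le_sum_card_childSet hΔ hfree <| by
          rw [mem_levelSet.1 hp]
          omega
      _ ≤ ∑ v ∈ levelSet lev (2 * j + 1), (childSet H lev v).card :=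
        hS.sum_childSet_le (by omega) _
      _ = ∑ v ∈ levelSet lev (2 * j + 1), ∑ _w ∈ childSet H lev v, 1 := by
        simp only [Finset.card_eq_sum_ones]
      _ ≤ ∑ _w ∈ levelSet lev (2 * j + 1 + 1), 1 := hS.sum_childSet_le (by omega) _
      _ = (levelSet lev (2 * (j + 1))).card := (Finset.card_eq_sum_ones _).symm

end IsStuck

end Growth

/-! ### Filling a hole by recoloring a ball -/

/-- The closed ball of radius `s` around `v`; unlike `SimpleGraph.ball`, it contains the nodes at
distance exactly `s`. -/
def nodeBall {V : Type} (G : SimpleGraph V) (s : ℕ) (v : V) : Set V :=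
  {u | G.edist v u ≤ s}

section Ball

variable {V : Type} {G : SimpleGraph V} {s t : ℕ} {u v w : V}

theorem mem_nodeBall_self (s : ℕ) (v : V) : v ∈ nodeBall G s v := by
  simp [nodeBall]

theorem mem_nodeBall_comm : u ∈ nodeBall G s v ↔ v ∈ nodeBall G s u := by
  simp [nodeBall, G.edist_comm (u := u)]

theorem nodeBall_subset_nodeBall (h : s ≤ t) : nodeBall G s v ⊆ nodeBall G t v :=
  fun _ hu => hu.out.trans (by exact_mod_cast h)

theorem nodeBall_mono {G' : SimpleGraph V} (h : G' ≤ G) : nodeBall G' s v ⊆ nodeBall G s v :=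
  fun _ hu => (SimpleGraph.edist_anti h).trans hu

theorem mem_nodeBall_trans (h₁ : u ∈ nodeBall G s v) (h₂ : w ∈ nodeBall G t u) :
    w ∈ nodeBall G (s + t) v := by
  simpa [nodeBall] using (SimpleGraph.edist_triangle (v := u)).trans (add_le_add h₁ h₂)

theorem mem_nodeBall_of_adj (h : G.Adj v u) : u ∈ nodeBall G 1 v := by
  simpa [nodeBall] using (SimpleGraph.edist_eq_one_iff_adj.2 h).le

theorem nodeBall_zero : nodeBall G 0 v = {v} := by
  ext u
  simp [nodeBall]

theorem mem_nodeBall_iff_exists_walk : u ∈ nodeBall G s v ↔ ∃ p : G.Walk v u, p.length ≤ s := by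
  constructor
  · intro h
    have hne : G.edist v u ≠ ⊤ := ne_top_of_le_ne_top (ENat.natCast_ne_top s) h
    obtain ⟨p, hp⟩ := SimpleGraph.exists_walk_of_edist_ne_top hne
    exact ⟨p, by exact_mod_cast hp.trans_le h⟩
  · rintro ⟨p, hp⟩
    exact (SimpleGraph.edist_le p).trans (by exact_mod_cast hp)

theorem mem_nodeBall_succ : u ∈ nodeBall G (s + 1) v ↔
    u ∈ nodeBall G s v ∨ ∃ w, G.Adj v w ∧ u ∈ nodeBall G s w := by
  constructor
  · rw [mem_nodeBall_iff_exists_walk]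
    rintro ⟨p, hp⟩
    cases p with
    | nil => exact Or.inl (mem_nodeBall_self _ _)
    | cons h p =>
      exact Or.inr ⟨_, h, mem_nodeBall_iff_exists_walk.2 ⟨p, Nat.le_of_succ_le_succ hp⟩⟩
  · rintro (h | ⟨w, hw, h⟩)
    · exact nodeBall_subset_nodeBall s.le_succ h
    · rw [Nat.add_comm]
      exact mem_nodeBall_trans (mem_nodeBall_of_adj hw) h

theorem nodeBall_succ :
    nodeBall G (s + 1) v = ⋃ w ∈ insert v (G.neighborSet v), nodeBall G s w := by
  ext u
  simp [mem_nodeBall_succ]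

end Ball

theorem exists_isLayering {V : Type} (H : SimpleGraph V) (c : V) (r : ℕ) :
    ∃ lev : V → ℕ, IsLayering H c r lev ∧ ∀ k ≤ r, {v | lev v ≤ k} = nodeBall H k c := by
  have hcoe : ∀ v, ∃ k : ℕ, (k : ℕ∞) = min (H.edist c v) (r + 1 : ℕ) := fun v =>
    ENat.ne_top_iff_exists.1 (ne_top_of_le_ne_top (ENat.natCast_ne_top (r + 1)) (min_le_right _ _))
  choose lev hlev using hcoe
  have hball : ∀ k ≤ r, ∀ v, lev v ≤ k ↔ v ∈ nodeBall H k c := fun k hk v => by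
    have hkr : ¬ r + 1 ≤ k := by omega
    rw [← ENat.natCast_le_natCast, hlev, min_le_iff, ENat.natCast_le_natCast, or_iff_left hkr]
    rfl
  have hsucc : ∀ u v, H.Adj u v → lev v ≤ lev u + 1 := fun u v huv => by
    obtain hu | hu := le_or_gt (lev u + 1) r
    · exact (hball _ hu v).2
        (mem_nodeBall_trans ((hball _ (by omega) u).1 le_rfl) (mem_nodeBall_of_adj huv))
    · have : (lev v : ℕ∞) ≤ (r + 1 : ℕ) := (hlev v).trans_le (min_le_right _ _)
      rw [ENat.natCast_le_natCast] at this
      omega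
  refine ⟨lev, ⟨fun v => ?_, hsucc, fun v hvc hv => ?_⟩, fun k hk => Set.ext (hball k hk)⟩
  · rw [← Nat.le_zero, hball 0 r.zero_le, nodeBall_zero, Set.mem_singleton_iff]
  · cases hk : lev v with
    | zero =>
      have h0 := (hball 0 r.zero_le v).1 hk.le
      rw [nodeBall_zero] at h0
      exact absurd h0 hvc
    | succ k =>
      have hmem := (hball _ hv v).1 le_rfl
      rw [hk, mem_nodeBall_comm, mem_nodeBall_succ] at hmem
      obtain h | ⟨w, hvw, h⟩ := hmem
      · have := (hball _ (by omega) v).2 (mem_nodeBall_comm.1 h)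
        omega
      · have := (hball _ (by omega) w).2 (mem_nodeBall_comm.1 h)
        have := hsucc w v hvw.symm
        exact ⟨w, hvw.symm, by omega⟩

theorem le_sub_one_pow_two_mul_clog {Δ : ℕ} (hΔ : 3 ≤ Δ) (q : ℕ) :
    q ≤ (Δ - 1) ^ (2 * Nat.clog Δ q) := by
  have hsq : Δ ≤ (Δ - 1) ^ 2 := by
    obtain ⟨d, rfl⟩ : ∃ d, Δ = d + 3 := ⟨Δ - 3, by omega⟩
    rw [Nat.add_sub_assoc (by norm_num)]
    nlinarith
  calc q ≤ Δ ^ Nat.clog Δ q := Nat.le_pow_clog (by omega) q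
    _ ≤ ((Δ - 1) ^ 2) ^ Nat.clog Δ q := Nat.pow_le_pow_left hsq _
    _ = (Δ - 1) ^ (2 * Nat.clog Δ q) := (pow_mul _ _ _).symm

section Recoloring

variable {V : Type} [Finite V] {H : SimpleGraph V} {Δ : ℕ} {φ : V → ℕ} {c : V} {r : ℕ}
  {lev : V → ℕ}

theorem IsStuck.le_ncard_nodeBall (hS : IsStuck H Δ φ c r lev)
    (hlev : {v | lev v ≤ r} = nodeBall H r c) (hΔ : 3 ≤ Δ) (hfree : H.CliqueFree (Δ + 1))
    {q : ℕ} (hr : 4 * Nat.clog Δ q ≤ r) : q ≤ (nodeBall H r c).ncard := by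
  have := Fintype.ofFinite V
  calc q ≤ (Δ - 1) ^ (2 * Nat.clog Δ q) := le_sub_one_pow_two_mul_clog hΔ q
    _ ≤ (levelSet lev (2 * (2 * Nat.clog Δ q))).card :=
      hS.pow_le_card_levelSet hΔ hfree (by omega)
    _ ≤ (nodeBall H r c).ncard := by
      rw [← Set.ncard_coe_finset, ← hlev]
      refine Set.ncard_le_ncard (fun v hv => ?_) (Set.toFinite _)
      have := mem_levelSet.1 hv
      exact show lev v ≤ r by omega

theorem IsStuck.lt_ncard_nodeBall (hS : IsStuck H Δ φ c r lev) (hr : 1 ≤ r) :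
    Δ < (nodeBall H r c).ncard := by
  have hsub : insert c (H.neighborSet c) ⊆ nodeBall H r c := by
    rintro u (rfl | hu)
    · exact mem_nodeBall_self _ _
    · exact nodeBall_subset_nodeBall hr (mem_nodeBall_of_adj hu)
  have hnotMem : c ∉ H.neighborSet c := fun h => H.irrefl h
  have hle := Set.ncard_le_ncard hsub (Set.toFinite _)
  rwa [Set.ncard_insert_of_notMem hnotMem (Set.toFinite _),
    hS.isHoleColoring.ncard_neighborSet hS.rigid] at hle

theorem exists_recoloring {q : ℕ} (hΔ : 3 ≤ Δ) (hdeg : ∀ v, (H.neighborSet v).ncard ≤ Δ)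
    (hq : 2 ≤ q) (hfree : Δ + 2 ≤ q → H.CliqueFree (Δ + 1)) (hr : 4 * Nat.clog Δ q ≤ r)
    (hball : (nodeBall H r c).ncard < q) (hφ : ∀ v, φ v ∈ Finset.Icc 1 Δ)
    (hprop : ∀ u v, u ≠ c → v ≠ c → H.Adj u v → φ u ≠ φ v) :
    ∃ ψ, IsProperColoring H Δ ψ ∧ Set.EqOn ψ φ (nodeBall H r c)ᶜ := by
  by_contra! hno
  obtain ⟨lev, hL, hlev⟩ := exists_isLayering H c r
  have hS : IsStuck H Δ φ c r lev :=
    { layering := hL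
      rigid := ⟨hdeg, by rwa [hlev r le_rfl]⟩
      isHoleColoring :=
        ⟨((hL.eq_zero_iff c).2 rfl).le.trans r.zero_le, hφ, hprop, Set.eqOn_refl _ _⟩ }
  by_cases hqΔ : Δ + 2 ≤ q
  · exact hball.not_ge (hS.le_ncard_nodeBall (hlev r le_rfl) hΔ (hfree hqΔ) hr)
  · have := Nat.clog_pos (show 1 < Δ by omega) hq
    have := hS.lt_ncard_nodeBall (by omega)
    omega

end Recoloring

/-! ### Color reduction with polynomials -/

section ColorReduction

open Polynomial

variable {K : Type*} [Field K] [Fintype K]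

theorem exists_eval_ne {f : K[X]} {k : ℕ} {S : Finset K[X]} (hf : f.natDegree ≤ k)
    (hS : ∀ g ∈ S, g.natDegree ≤ k) (hfS : f ∉ S) (hcard : S.card * k < Fintype.card K) :
    ∃ x, ∀ g ∈ S, f.eval x ≠ g.eval x := by
  classical
  set agreeing := S.biUnion fun g => (f - g).roots.toFinset
  have hle : agreeing.card ≤ S.card * k := Finset.card_biUnion_le_card_mul _ _ _ fun g hg =>
    (Multiset.toFinset_card_le _).trans <| (card_roots' _).trans <|
      (natDegree_sub_le _ _).trans (max_le hf (hS g hg))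
  obtain ⟨x, hx⟩ : ∃ x, x ∉ agreeing := by
    by_contra! hall
    rw [Finset.eq_univ_of_forall hall, Finset.card_univ] at hle
    omega
  refine ⟨x, fun g hg heq => hx (Finset.mem_biUnion.2 ⟨g, hg, ?_⟩)⟩
  have hne : f ≠ g := fun h => hfS (h ▸ hg)
  simp [sub_ne_zero.2 hne, heq]

variable (K) in
theorem exists_injOn_natDegree_le {k M : ℕ} (hM : M ≤ Fintype.card K ^ (k + 1)) :
    ∃ P : ℕ → K[X], (∀ a, (P a).natDegree ≤ k) ∧ Set.InjOn P (Set.Iio M) := by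
  obtain ⟨e⟩ : Nonempty (Fin M ↪ (Fin (k + 1) → K)) :=
    Function.Embedding.nonempty_of_card_le (by simpa using hM)
  let poly (v : Fin (k + 1) → K) : degreeLT K (k + 1) := (degreeLTEquiv K (k + 1)).symm v
  refine ⟨fun a => if h : a < M then poly (e ⟨a, h⟩) else 0, fun a => ?_, ?_⟩
  · dsimp only
    split_ifs with h
    · exact natDegree_le_of_degree_le (Order.lt_succ_iff.1 (mem_degreeLT.1 (poly (e ⟨a, h⟩)).2))
    · simp
  · intro a ha b hb hab
    simp only [Set.mem_Iio.1 ha, Set.mem_Iio.1 hb, dif_pos] at hab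
    simpa using e.injective ((degreeLTEquiv K (k + 1)).symm.injective (Subtype.ext hab))

open Classical in
variable (K) in
/-- The colors `0, …, M - 1` are encoded by distinct polynomials of degree at most `k`. A node with
the color `a` and with at most `d` conflicting colors `A` picks a point of the graph of its
polynomial that is not on the graphs of the polynomials of `A`. -/
theorem exists_colorReduction {d k M : ℕ} (hdk : d * k < Fintype.card K)
    (hM : M ≤ Fintype.card K ^ (k + 1)) :
    ∃ F : ℕ → Set ℕ → ℕ, (∀ a A, F a A < Fintype.card K ^ 2) ∧
      ∀ a b A B, a < M → A ⊆ Set.Iio M → A.ncard ≤ d → a ∉ A → b ∈ A → F a A ≠ F b B := by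
  obtain ⟨P, hdeg, hinj⟩ := exists_injOn_natDegree_le K hM
  let IsSeparating (a : ℕ) (A : Set ℕ) (x : K) : Prop := ∀ b ∈ A, (P a).eval x ≠ (P b).eval x
  let point (a : ℕ) (A : Set ℕ) : K := Classical.epsilon (IsSeparating a A)
  have hpoint : ∀ a A, a < M → A ⊆ Set.Iio M → A.ncard ≤ d → a ∉ A →
      IsSeparating a A (point a A) := by
    intro a A ha hA hcard haA
    have hfin : A.Finite := (Set.finite_Iio M).subset hA
    have hnotMem : P a ∉ hfin.toFinset.image P := by
      intro h
      obtain ⟨b, hb, hab⟩ := Finset.mem_image.1 h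
      rw [hfin.mem_toFinset] at hb
      exact haA (hinj (hA hb) ha hab ▸ hb)
    have hcardP : (hfin.toFinset.image P).card ≤ d :=
      Finset.card_image_le.trans (Set.ncard_eq_toFinset_card A hfin ▸ hcard)
    obtain ⟨x, hx⟩ := exists_eval_ne (hdeg a) (by simp [hdeg]) hnotMem
      ((Nat.mul_le_mul_right k hcardP).trans_lt hdk)
    exact Classical.epsilon_spec (p := IsSeparating a A)
      ⟨x, fun b hb => hx (P b) (Finset.mem_image_of_mem P (hfin.mem_toFinset.2 hb))⟩
  let code : K × K ≃ Fin (Fintype.card K ^ 2) := Fintype.equivFinOfCardEq (by simp [sq])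
  refine ⟨fun a A => code (point a A, (P a).eval (point a A)), fun a A => (code _).2, ?_⟩
  intro a b A B ha hA hcard haA hb heq
  obtain ⟨hx, hy⟩ := Prod.mk.inj (code.injective (Fin.ext heq))
  exact hpoint a A ha hA hcard haA b hb (hx ▸ hy)

end ColorReduction

/-! ### The number of color reductions -/

theorem logb_two_add_one_le {x : ℝ} (hx : 1 ≤ x) : Real.logb 2 (x + 1) ≤ x := by
  rw [Real.logb_le_iff_le_rpow one_lt_two (by linarith)]
  have := one_add_mul_self_le_rpow_one_add (s := (1 : ℝ)) (by norm_num) hx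
  norm_num at this
  linarith

theorem logb_two_le_self {x : ℝ} (hx : 1 ≤ x) : Real.logb 2 x ≤ x :=
  (Real.logb_le_logb_of_le one_lt_two (by linarith) (by linarith)).trans (logb_two_add_one_le hx)

theorem exists_iterate_logb_two_le_one (x : ℝ) : ∃ k : ℕ, (Real.logb 2)^[k] x ≤ 1 := by
  obtain ⟨m, hm⟩ := exists_nat_ge x
  induction m generalizing x with
  | zero => exact ⟨0, hm.trans (by simp)⟩
  | succ m ih =>
    push_cast at hm
    obtain h1 | h1 := le_or_gt x 1
    · exact ⟨0, h1⟩
    obtain h2 | h2 := le_or_gt x 2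
    · exact ⟨1, by simpa [Real.logb_le_iff_le_rpow one_lt_two (zero_lt_one.trans h1)] using h2⟩
    have hlog := logb_two_add_one_le (x := x - 1) (by linarith)
    rw [sub_add_cancel] at hlog
    obtain ⟨k, hk⟩ := ih (Real.logb 2 x) (by linarith)
    exact ⟨k + 1, hk⟩

theorem iterate_logStar_le (n : ℕ) : (Real.logb 2)^[logStar n] (n : ℝ) ≤ 1 :=
  Nat.sInf_mem (exists_iterate_logb_two_le_one n)

theorem one_lt_iterate_of_lt_logStar {n t : ℕ} (h : t < logStar n) :
    1 < (Real.logb 2)^[t] (n : ℝ) :=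
  not_le.1 (Nat.notMem_of_lt_sInf h)

theorem logStar_pos {n : ℕ} (hn : 2 ≤ n) : 0 < logStar n := by
  refine Nat.pos_of_ne_zero fun h0 => ?_
  have h1 := iterate_logStar_le n
  rw [h0, Function.iterate_zero, id, Nat.cast_le_one] at h1
  omega

theorem cast_clog_two_le {m : ℕ} (hm : 1 ≤ m) : (Nat.clog 2 m : ℝ) ≤ Real.logb 2 m + 1 := by
  rw [← Real.natCeil_logb_natCast 2 m]
  exact (Nat.ceil_lt_add_one (Real.logb_nonneg (by norm_num) (by exact_mod_cast hm))).le

theorem two_pow_clog_le {d : ℕ} (hd : 1 ≤ d) : 2 ^ Nat.clog 2 d ≤ 2 * d := by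
  obtain rfl | hd1 := hd.eq_or_lt
  · simp
  obtain ⟨m, hm⟩ := Nat.exists_eq_add_of_lt (Nat.clog_pos one_lt_two hd1)
  have hlt := Nat.pow_pred_clog_lt_self one_lt_two hd1
  rw [hm, zero_add] at hlt ⊢
  rw [pow_succ]
  simp only [Nat.pred_eq_sub_one, Nat.add_sub_cancel] at hlt
  omega

/-- A bound on the binary length of the colors after a number of color reductions, starting from
length `L`, if every node has at most `d` conflicts. -/
def colorLength (d L : ℕ) : ℕ → ℕ
  | 0 => L
  | t + 1 => 2 + 2 * Nat.clog 2 d + 2 * Nat.clog 2 (colorLength d L t)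

theorem colorLength_pos {d L : ℕ} (hL : 1 ≤ L) (t : ℕ) : 1 ≤ colorLength d L t := by
  cases t with
  | zero => exact hL
  | succ t => simp only [colorLength]; omega

/-- After `logStar n` reductions the colors have the binary length `O(log d)`; this is the constant
for identifiers from `{1, …, n ^ c}`. -/
def lengthConst (c : ℕ) : ℕ := c + 2 + 2 ^ (c + 7)

theorem logb_two_add_le {x y : ℝ} (hx : 1 ≤ x) (hy : 1 ≤ y) :
    Real.logb 2 (x + y) ≤ 1 + Real.logb 2 x + Real.logb 2 y := by
  have hmul : Real.logb 2 (2 * x * y) = 1 + Real.logb 2 x + Real.logb 2 y := by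
    rw [Real.logb_mul (by positivity) (by positivity), Real.logb_mul (by norm_num)
      (by positivity), Real.logb_self_eq_one one_lt_two]
  rw [← hmul]
  exact Real.logb_le_logb_of_le one_lt_two (by linarith) (by nlinarith)

/-- The step of the induction in `colorLength_le`: the logarithm of the old bound is absorbed by
the summand `2 ^ (c + 7) * A`, up to the logarithm of `y`. -/
theorem two_mul_logb_add_le {c : ℕ} {A l y : ℝ} (hA : 1 ≤ A) (hl : 0 < l) (hy : 1 ≤ y)
    (h : l ≤ (c + 2) * y + 2 ^ (c + 7) * A) :
    2 * A + 2 * (Real.logb 2 l + 1) ≤ (c + 2) * max 1 (Real.logb 2 y) + 2 ^ (c + 7) * A := by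
  have : (0 : ℝ) ≤ c := c.cast_nonneg
  have hpow : (1 : ℝ) ≤ 2 ^ (c + 7) := one_le_pow₀ (by norm_num)
  have hconst : (4 * c + 26 : ℝ) ≤ 2 ^ (c + 7) := by
    have : (c + 1 : ℝ) ≤ 2 ^ c := by exact_mod_cast Nat.lt_two_pow_self
    rw [pow_add]
    linarith
  have hlogl : Real.logb 2 l ≤ 1 + (Real.logb 2 (c + 2) + Real.logb 2 y) +
      (c + 7 + Real.logb 2 A) := by
    have hadd := logb_two_add_le (x := (c + 2) * y) (y := 2 ^ (c + 7) * A) (by nlinarith)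
      (by nlinarith)
    rw [Real.logb_mul (by positivity) (by positivity), Real.logb_mul (by positivity)
      (by positivity), Real.logb_pow, Real.logb_self_eq_one one_lt_two] at hadd
    push_cast at hadd
    linarith [Real.logb_le_logb_of_le one_lt_two hl h]
  have hlogc := logb_two_le_self (show (1 : ℝ) ≤ c + 2 by linarith)
  have hlogA := logb_two_le_self hA
  have hmax : 2 * Real.logb 2 y ≤ (c + 2) * max 1 (Real.logb 2 y) := by
    nlinarith [le_max_left 1 (Real.logb 2 y), le_max_right 1 (Real.logb 2 y)]
  nlinarith

theorem colorLength_le {c d n t : ℕ} (ht : t ≤ logStar n) :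
    (colorLength d (c * n + 1) t : ℝ) ≤
      (c + 2) * max 1 ((Real.logb 2)^[t] n) + 2 ^ (c + 7) * (1 + Nat.clog 2 d) := by
  induction t with
  | zero =>
    have h1 : (1 : ℝ) ≤ max 1 (n : ℝ) := le_max_left _ _
    have hn : (n : ℝ) ≤ max 1 (n : ℝ) := le_max_right _ _
    have hconst : (0 : ℝ) ≤ 2 ^ (c + 7) * (1 + Nat.clog 2 d) := by positivity
    simp only [colorLength, Function.iterate_zero, id]
    push_cast
    nlinarith [mul_le_mul_of_nonneg_left hn c.cast_nonneg]
  | succ t ih =>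
    have hx := one_lt_iterate_of_lt_logStar ht
    have hpos := colorLength_pos (d := d) (Nat.le_add_left 1 (c * n)) t
    have hprev := ih (Nat.le_of_succ_le ht)
    rw [max_eq_right hx.le] at hprev
    have hstep := two_mul_logb_add_le (le_add_of_nonneg_right (Nat.cast_nonneg _))
      (by exact_mod_cast hpos) hx.le hprev
    rw [← Function.iterate_succ_apply' (Real.logb 2)] at hstep
    refine le_trans ?_ hstep
    simp only [colorLength]
    push_cast
    linarith [cast_clog_two_le hpos]

theorem colorLength_logStar_le (c d n : ℕ) :
    colorLength d (c * n + 1) (logStar n) ≤ lengthConst c * (1 + Nat.clog 2 d) := by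
  have h := colorLength_le (c := c) (d := d) (le_refl (logStar n))
  rw [max_eq_left (iterate_logStar_le n)] at h
  have hcast : (colorLength d (c * n + 1) (logStar n) : ℝ) ≤
      (lengthConst c * (1 + Nat.clog 2 d) : ℕ) := by
    refine h.trans ?_
    have : (0 : ℝ) ≤ (c + 2) * Nat.clog 2 d := by positivity
    simp only [lengthConst]
    push_cast
    linarith
  exact_mod_cast hcast

/-! ### Local functions -/

/-- The networks on which an algorithm has to work, bundled: those with `n` nodes and maximum degree
at most `Δ` which, if `excl` holds, do not contain the complete graph on `Δ + 1` nodes. -/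
structure Network (c n Δ : ℕ) (excl : Prop) where
  V : Type
  [fintype : Fintype V]
  G : SimpleGraph V
  [decidable : DecidableRel G.Adj]
  ident : V → ℕ
  isNetwork : IsNetwork c n Δ G ident
  cliqueFree : excl → G.CliqueFree (Δ + 1)

attribute [instance] Network.fintype Network.decidable

/-- A quantity that every node of every network has, such as the output of an algorithm. -/
abbrev NodeFun (c n Δ : ℕ) (excl : Prop) (α : Type) : Type 1 :=
  (N : Network c n Δ excl) → N.V → α

/-- The values of `Network.view`: the identifier and the degree of a node at first, and then in each
round the previous view together with the previous views of the neighbors. -/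
def ViewType : ℕ → Type
  | 0 => ℕ × ℕ
  | t + 1 => ViewType t × Set (ViewType t)

/-- What a node knows after a number of rounds in which every node sends everything it knows. -/
def Network.view {c n Δ : ℕ} {excl : Prop} (N : Network c n Δ excl) : (t : ℕ) → N.V → ViewType t
  | 0 => fun v => (N.ident v, N.G.degree v)
  | t + 1 => fun v => (N.view t v, N.view t '' N.G.neighborSet v)

/-- `f` can be computed in `R` rounds. Locality is expressed without reference to an algorithm: the
value of `f` at a node is determined by what the node can know after `R` rounds. -/
def IsLocal {c n Δ : ℕ} {excl : Prop} {α : Type} (R : ℕ) (f : NodeFun c n Δ excl α) : Prop :=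
  ∃ g : ViewType R → α, ∀ N v, f N v = g (N.view R v)

section Local

variable {c n Δ R R' : ℕ} {excl : Prop} {α β γ : Type}

theorem IsLocal.congr {f f' : NodeFun c n Δ excl α} (h : IsLocal R f)
    (heq : ∀ N v, f' N v = f N v) : IsLocal R f' := by
  obtain ⟨g, hg⟩ := h
  exact ⟨g, fun N v => (heq N v).trans (hg N v)⟩

theorem IsLocal.succ {f : NodeFun c n Δ excl α} (h : IsLocal R f) : IsLocal (R + 1) f := by
  obtain ⟨g, hg⟩ := h
  exact ⟨fun w => g w.1, hg⟩

theorem IsLocal.mono {f : NodeFun c n Δ excl α} (h : IsLocal R f) (hR : R ≤ R') :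
    IsLocal R' f := by
  induction hR with
  | refl => exact h
  | step _ ih => exact ih.succ

theorem IsLocal.map {f : NodeFun c n Δ excl α} (h : IsLocal R f) (F : α → β) :
    IsLocal R fun N v => F (f N v) := by
  obtain ⟨g, hg⟩ := h
  exact ⟨fun w => F (g w), fun N v => congrArg F (hg N v)⟩

theorem IsLocal.map₂ {f : NodeFun c n Δ excl α} {f' : NodeFun c n Δ excl β} (h : IsLocal R f)
    (h' : IsLocal R f') (F : α → β → γ) : IsLocal R fun N v => F (f N v) (f' N v) := by
  obtain ⟨g, hg⟩ := h
  obtain ⟨g', hg'⟩ := h'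
  exact ⟨fun w => F (g w) (g' w), fun N v => congrArg₂ F (hg N v) (hg' N v)⟩

theorem IsLocal.prodMk {f : NodeFun c n Δ excl α} {f' : NodeFun c n Δ excl β} (h : IsLocal R f)
    (h' : IsLocal R f') : IsLocal R fun N v => (f N v, f' N v) :=
  h.map₂ h' Prod.mk

theorem IsLocal.pi {ι : Type} {f : ι → NodeFun c n Δ excl α} (h : ∀ i, IsLocal R (f i)) :
    IsLocal R fun N v i => f i N v := by
  choose g hg using h
  exact ⟨fun w i => g i w, fun N v => funext fun i => hg i N v⟩

theorem isLocal_const (R : ℕ) (a : α) : IsLocal R fun (N : Network c n Δ excl) (_ : N.V) => a :=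
  ⟨fun _ => a, fun _ _ => rfl⟩

theorem isLocal_ident (R : ℕ) : IsLocal R fun (N : Network c n Δ excl) v => N.ident v :=
  IsLocal.mono (R := 0) ⟨Prod.fst, fun _ _ => rfl⟩ R.zero_le

theorem IsLocal.image_neighborSet {f : NodeFun c n Δ excl α} (h : IsLocal R f) :
    IsLocal (R + 1) fun N v => f N '' N.G.neighborSet v := by
  obtain ⟨g, hg⟩ := h
  refine ⟨fun w => g '' w.2, fun N v => ?_⟩
  change f N '' _ = g '' (N.view R '' _)
  rw [Set.image_image]
  exact Set.image_congr fun u _ => hg N u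

theorem IsLocal.image_nodeBall {f : NodeFun c n Δ excl α} (h : IsLocal R f) (s : ℕ) :
    IsLocal (R + s) fun N v => f N '' nodeBall N.G s v := by
  induction s with
  | zero =>
    refine (h.map fun a => ({a} : Set α)).congr fun N v => ?_
    rw [nodeBall_zero, Set.image_singleton]
  | succ s ih =>
    refine (ih.succ.map₂ ih.image_neighborSet fun A B => A ∪ ⋃₀ B).congr fun N v => ?_
    rw [nodeBall_succ, Set.biUnion_insert, Set.image_union, Set.image_iUnion₂, Set.sUnion_image]

theorem LocalAlgorithm.inbox_eq_some_iff {In Out V : Type} [Fintype V]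
    (A : LocalAlgorithm In Out) {G : SimpleGraph V} {ident : V → ℕ} (hident : ident.Injective)
    (s : V → A.State) {v : V} {i : ℕ} {m : A.Msg} :
    A.inbox G ident s v i = some m ↔
      ∃ u, G.Adj v u ∧ ident u = i ∧ A.send (s u) (ident v) = m := by
  unfold inbox
  split_ifs with h
  · rw [Option.some_inj]
    refine ⟨fun hm => ⟨h.choose, h.choose_spec.1, h.choose_spec.2, hm⟩, ?_⟩
    rintro ⟨u, -, hu, rfl⟩
    rw [hident (h.choose_spec.2.trans hu.symm)]
  · refine ⟨fun hm => by contradiction, ?_⟩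
    rintro ⟨u, hvu, hu, -⟩
    exact absurd ⟨u, hvu, hu⟩ h

/-- The algorithm in which all nodes send everything they know in `R` rounds and then apply `g`. The
value `a₀` is a default output that is never used after `R` rounds. -/
def viewAlgorithm (R : ℕ) (a₀ : α) (g : ViewType R → α) : LocalAlgorithm Unit α where
  State := Σ t, ViewType t
  Msg := Σ t, ViewType t
  init _ _ ident degree _ := ⟨0, (ident, degree)⟩
  send s _ := s
  receive s inbox := ⟨s.1 + 1, (s.2, {w | ∃ i, inbox i = some ⟨s.1, w⟩})⟩
  output s := if h : s.1 = R then g (h ▸ s.2) else a₀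

theorem viewAlgorithm_stateAfter (a₀ : α) (g : ViewType R → α) (N : Network c n Δ excl) (t : ℕ) :
    (viewAlgorithm R a₀ g).stateAfter n Δ N.G N.ident (fun _ => ()) t =
      fun v => ⟨t, N.view t v⟩ := by
  induction t with
  | zero => rfl
  | succ t ih =>
    funext v
    let A := viewAlgorithm R a₀ g
    have hinbox : {w | ∃ i, A.inbox N.G N.ident (fun v => ⟨t, N.view t v⟩) v i = some ⟨t, w⟩} =
        N.view t '' N.G.neighborSet v := by
      ext w
      refine (exists_congr fun i => A.inbox_eq_some_iff N.isNetwork.ident_injective _).trans ?_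
      simp [A, viewAlgorithm]
    rw [LocalAlgorithm.stateAfter, ih]
    exact congrArg (fun S => (⟨t + 1, (N.view t v, S)⟩ : Σ t, ViewType t)) hinbox

theorem IsLocal.exists_algorithm [Nonempty α] {f : NodeFun c n Δ excl α} (h : IsLocal R f) :
    ∃ A : LocalAlgorithm Unit α, ∀ N, A.run n Δ N.G N.ident (fun _ => ()) R = f N := by
  obtain ⟨g, hg⟩ := h
  obtain ⟨a₀⟩ := ‹Nonempty α›
  refine ⟨viewAlgorithm R a₀ g, fun N => funext fun v => ?_⟩
  rw [LocalAlgorithm.run, viewAlgorithm_stateAfter, hg]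
  simp [viewAlgorithm]

/-- The subgraph of `G` on which an algorithm is run when only the nodes in `act` take part; the
other nodes are kept as isolated nodes. -/
def activeGraph {V : Type} (G : SimpleGraph V) (act : V → Prop) : SimpleGraph V where
  Adj u v := G.Adj u v ∧ act u ∧ act v
  symm := ⟨fun _ _ h => ⟨h.1.symm, h.2.2, h.2.1⟩⟩
  loopless := ⟨fun _ h => G.irrefl h.1⟩

theorem activeGraph_le {V : Type} (G : SimpleGraph V) (act : V → Prop) : activeGraph G act ≤ G :=
  fun _ _ h => h.1

noncomputable instance {V : Type} (G : SimpleGraph V) (act : V → Prop) :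
    DecidableRel (activeGraph G act).Adj := Classical.decRel _

theorem degree_eq_ncard {V : Type} [Fintype V] (G : SimpleGraph V) [DecidableRel G.Adj] (v : V) :
    G.degree v = (G.neighborSet v).ncard := by
  rw [← SimpleGraph.card_neighborSet_eq_degree, Set.ncard_eq_toFinset_card', Set.toFinset_card]

theorem IsLocal.degree_activeGraph {act : NodeFun c n Δ excl Prop} (h : IsLocal R act) :
    IsLocal (R + 1) fun N v => (activeGraph N.G (act N)).degree v := by
  refine (h.succ.map₂ (h.prodMk (isLocal_ident R)).image_neighborSet fun (a : Prop) S =>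
    Set.ncard {i | a ∧ (True, i) ∈ S}).congr fun N v => ?_
  rw [degree_eq_ncard, ← Set.ncard_image_of_injective _ N.isNetwork.ident_injective]
  congr 1
  ext i
  simp only [Set.mem_image, SimpleGraph.mem_neighborSet, Set.mem_ofPred_eq, Prod.mk.injEq,
    eq_iff_iff, iff_true]
  constructor
  · rintro ⟨u, ⟨hvu, hv, hu⟩, rfl⟩
    exact ⟨hv, u, hvu, hu, rfl⟩
  · rintro ⟨hv, u, hvu, hu, rfl⟩
    exact ⟨u, ⟨hvu, hv, hu⟩, rfl⟩

theorem IsLocal.inbox {In Out : Type} (A : LocalAlgorithm In Out) {act : NodeFun c n Δ excl Prop}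
    {s : NodeFun c n Δ excl A.State} (hact : IsLocal R act) (hs : IsLocal R s) :
    IsLocal (R + 1) fun N v => A.inbox (activeGraph N.G (act N)) N.ident (s N) v := by
  let IsMessage (own : Prop × ℕ) (nbrs : Set (A.State × Prop × ℕ)) (i : ℕ) (m : A.Msg) : Prop :=
    own.1 ∧ ∃ s, (s, True, i) ∈ nbrs ∧ A.send s own.2 = m
  have hown := hact.prodMk (isLocal_ident R)
  let IsEntry (own : Prop × ℕ) (nbrs : Set (A.State × Prop × ℕ)) (i : ℕ) (o : Option A.Msg) :
      Prop := ∀ m, o = some m ↔ IsMessage own nbrs i m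
  refine (hown.succ.map₂ (hs.prodMk hown).image_neighborSet fun own nbrs i =>
    Classical.epsilon (IsEntry own nbrs i)).congr fun N v => funext fun i => ?_
  have hentry : IsEntry (act N v, N.ident v)
      ((fun u => (s N u, act N u, N.ident u)) '' N.G.neighborSet v) i
      (A.inbox (activeGraph N.G (act N)) N.ident (s N) v i) := by
    intro m
    rw [A.inbox_eq_some_iff N.isNetwork.ident_injective]
    simp only [IsMessage, Set.mem_image, SimpleGraph.mem_neighborSet, Prod.mk.injEq, eq_iff_iff,
      iff_true]
    constructor
    · rintro ⟨u, ⟨hvu, hv, hu⟩, hi, hm⟩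
      exact ⟨hv, _, ⟨u, hvu, rfl, hu, hi⟩, hm⟩
    · rintro ⟨hv, _, ⟨u, hvu, rfl, hu, hi⟩, hm⟩
      exact ⟨u, ⟨hvu, hv, hu⟩, hi, hm⟩
  exact Option.ext fun m => (hentry m).trans (Classical.epsilon_spec ⟨_, hentry⟩ m).symm

theorem IsLocal.run {In Out : Type} (A : LocalAlgorithm In Out) {act : NodeFun c n Δ excl Prop}
    {x : NodeFun c n Δ excl In} (hact : IsLocal R act) (hx : IsLocal R x) (T : ℕ) :
    IsLocal (R + 1 + T) fun N v => A.run n Δ (activeGraph N.G (act N)) N.ident (x N) T v := by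
  suffices hstate : ∀ t, IsLocal (R + 1 + t) fun N v =>
      A.stateAfter n Δ (activeGraph N.G (act N)) N.ident (x N) t v from (hstate T).map A.output
  intro t
  induction t with
  | zero =>
    exact ((hx.succ.prodMk hact.degree_activeGraph).prodMk (isLocal_ident (R + 1))).map fun y =>
      A.init n Δ y.2 y.1.2 y.1.1
  | succ t ih => exact ih.succ.map₂ ((hact.mono (by omega)).inbox A ih) A.receive

end Local

/-! ### Colorings of powers of the network -/

theorem ncard_nodeBall_le {V : Type} [Finite V] {G : SimpleGraph V} {Δ : ℕ}
    (hdeg : ∀ v, (G.neighborSet v).ncard ≤ Δ) (s : ℕ) (v : V) :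
    (nodeBall G s v).ncard ≤ (Δ + 1) ^ s := by
  classical
  induction s generalizing v with
  | zero => simp [nodeBall_zero]
  | succ s ih =>
    let S := (Set.toFinite (insert v (G.neighborSet v))).toFinset
    have hS : S.card ≤ Δ + 1 := by
      rw [← Set.ncard_eq_toFinset_card]
      exact (Set.ncard_insert_le _ _).trans (Nat.succ_le_succ (hdeg v))
    calc (nodeBall G (s + 1) v).ncard = (⋃ w ∈ S, nodeBall G s w).ncard := by
          simp only [S, Set.Finite.mem_toFinset, nodeBall_succ]
      _ ≤ ∑ w ∈ S, (nodeBall G s w).ncard := S.set_ncard_biUnion_le _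
      _ ≤ S.card * (Δ + 1) ^ s := Finset.sum_le_card_nsmul _ _ _ fun w _ => ih w
      _ ≤ (Δ + 1) * (Δ + 1) ^ s := Nat.mul_le_mul_right _ hS
      _ = (Δ + 1) ^ (s + 1) := (pow_succ' _ _).symm

/-- `col` is a proper coloring, with colors below `M`, of the `s`-th power of `G`, in which nodes
within distance `s` are adjacent. -/
def IsPowerColoring {V : Type} (G : SimpleGraph V) (s M : ℕ) (col : V → ℕ) : Prop :=
  (∀ v, col v < M) ∧ ∀ u v, u ≠ v → u ∈ nodeBall G s v → col u ≠ col v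

theorem IsPowerColoring.mono {V : Type} {G : SimpleGraph V} {s M M' : ℕ} {col : V → ℕ}
    (h : IsPowerColoring G s M col) (hM : M ≤ M') : IsPowerColoring G s M' col :=
  ⟨fun v => (h.1 v).trans_le hM, h.2⟩

section PowerColoring

variable {c n Δ R : ℕ} {excl : Prop}

theorem Network.ncard_neighborSet_le (N : Network c n Δ excl) (v : N.V) :
    (N.G.neighborSet v).ncard ≤ Δ := by
  rw [← degree_eq_ncard]
  exact (N.G.degree_le_maxDegree v).trans N.isNetwork.maxDegree_le

theorem exists_reducedColoring {s M k p : ℕ} {col : NodeFun c n Δ excl ℕ} (hcol : IsLocal R col)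
    (hM : ∀ N, IsPowerColoring N.G s M (col N)) (hp : p.Prime) (hdk : (Δ + 1) ^ s * k < p)
    (hMp : M ≤ p ^ (k + 1)) :
    ∃ col' : NodeFun c n Δ excl ℕ, IsLocal (R + s) col' ∧
      ∀ N, IsPowerColoring N.G s (p ^ 2) (col' N) := by
  have := Fact.mk hp
  rw [← ZMod.card p] at hdk hMp ⊢
  obtain ⟨F, hFlt, hFne⟩ := exists_colorReduction (ZMod p) hdk hMp
  let conflicts : NodeFun c n Δ excl (Set ℕ) := fun N v => col N '' nodeBall N.G s v \ {col N v}
  refine ⟨fun N v => F (col N v) (conflicts N v),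
    (hcol.mono (R.le_add_right s)).map₂ (hcol.image_nodeBall s) fun a A => F a (A \ {a}),
    fun N => ⟨fun v => hFlt _ _, fun u v huv huball => ?_⟩⟩
  have hlt : conflicts N u ⊆ Set.Iio M := by
    rintro _ ⟨⟨w, -, rfl⟩, -⟩
    exact (hM N).1 w
  have hcard : (conflicts N u).ncard ≤ (Δ + 1) ^ s :=
    (Set.ncard_le_ncard Set.sdiff_subset (Set.toFinite _)).trans <|
      (Set.ncard_image_le (Set.toFinite _)).trans (ncard_nodeBall_le N.ncard_neighborSet_le s u)
  have hmem : col N v ∈ conflicts N u :=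
    ⟨⟨v, mem_nodeBall_comm.1 huball, rfl⟩, fun h => (hM N).2 u v huv huball h.symm⟩
  exact hFne _ _ _ _ ((hM N).1 u) hlt hcard (fun h => h.2 rfl) hmem

theorem exists_powerColoring_two_pow_colorLength (s t : ℕ) :
    ∃ col : NodeFun c n Δ excl ℕ, IsLocal (s * t) col ∧
      ∀ N, IsPowerColoring N.G s (2 ^ colorLength ((Δ + 1) ^ s) (c * n + 1) t) (col N) := by
  induction t with
  | zero =>
    refine ⟨fun N => N.ident, isLocal_ident _, fun N => ⟨fun v => ?_, fun u v huv _ h =>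
      huv (N.isNetwork.ident_injective h)⟩⟩
    calc N.ident v ≤ n ^ c := (Finset.mem_Icc.1 (N.isNetwork.ident_mem v)).2
      _ ≤ (2 ^ n) ^ c := Nat.pow_le_pow_left Nat.lt_two_pow_self.le c
      _ = 2 ^ (c * n) := by rw [mul_comm, pow_mul]
      _ < 2 ^ (c * n + 1) := Nat.pow_lt_pow_succ one_lt_two
  | succ t ih =>
    obtain ⟨col, hcol, hpower⟩ := ih
    let d := (Δ + 1) ^ s
    set L := colorLength d (c * n + 1) t
    have hdL : 0 < d * L := Nat.mul_pos (by positivity) (colorLength_pos (by omega) t)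
    obtain ⟨p, hp, hlt, hle⟩ := Nat.exists_prime_lt_and_le_two_mul (d * L) hdL.ne'
    obtain ⟨col', hcol', hpower'⟩ := exists_reducedColoring hcol hpower hp hlt
      ((Nat.pow_le_pow_left hp.two_le L).trans (Nat.pow_le_pow_right hp.pos L.le_succ))
    refine ⟨col', hcol', fun N => (hpower' N).mono ?_⟩
    calc p ^ 2 ≤ (2 * (d * L)) ^ 2 := Nat.pow_le_pow_left hle 2
      _ ≤ (2 * (2 ^ Nat.clog 2 d * 2 ^ Nat.clog 2 L)) ^ 2 := by
          gcongr <;> exact Nat.le_pow_clog one_lt_two _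
      _ = 2 ^ (2 + 2 * Nat.clog 2 d + 2 * Nat.clog 2 L) := by ring

/-- Colors of length `O(log d)` can be encoded by polynomials of constant degree over a field with
`O(d)` elements. One more reduction therefore leaves `O(d ^ 2)` colors, where `d = (Δ + 1) ^ s`
bounds the degree of the power of the network. -/
theorem exists_powerColoring (s : ℕ) :
    ∃ col : NodeFun c n Δ excl ℕ, IsLocal (s * (logStar n + 1)) col ∧
      ∀ N, IsPowerColoring N.G s (64 * (lengthConst c * (Δ + 1) ^ s) ^ 2) (col N) := by
  obtain ⟨col, hcol, hpower⟩ := exists_powerColoring_two_pow_colorLength (c := c) (n := n)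
    (Δ := Δ) (excl := excl) s (logStar n)
  set d := (Δ + 1) ^ s
  set k := lengthConst c
  have hd : 1 ≤ d := Nat.one_le_pow _ _ (by omega)
  have hk1 : 1 ≤ k := by
    exact (by omega : 1 ≤ c + 2).trans (Nat.le_add_right _ _)
  obtain ⟨p, hp, hlt, hle⟩ := Nat.exists_prime_lt_and_le_two_mul (4 * d * k) (by positivity)
  have hM : 2 ^ colorLength d (c * n + 1) (logStar n) ≤ p ^ (k + 1) :=
    calc 2 ^ colorLength d (c * n + 1) (logStar n) ≤ 2 ^ (k * (1 + Nat.clog 2 d)) :=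
          Nat.pow_le_pow_right two_pos (colorLength_logStar_le c d n)
      _ = (2 * 2 ^ Nat.clog 2 d) ^ k := by rw [mul_comm k, pow_mul, pow_add, pow_one]
      _ ≤ p ^ k := by
          refine Nat.pow_le_pow_left ?_ k
          have := two_pow_clog_le hd
          nlinarith
      _ ≤ p ^ (k + 1) := Nat.pow_le_pow_right hp.pos k.le_succ
  obtain ⟨col', hcol', hpower'⟩ := exists_reducedColoring (k := k) hcol hpower hp
    (lt_of_le_of_lt (Nat.mul_le_mul_right k (by omega : d ≤ 4 * d)) hlt) hM
  refine ⟨col', hcol', fun N => (hpower' N).mono ?_⟩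
  calc p ^ 2 ≤ (2 * (4 * d * k)) ^ 2 := Nat.pow_le_pow_left hle 2
    _ = 64 * (k * d) ^ 2 := by ring

end PowerColoring

/-! ### Ruling sets -/

/-- Distinct nodes of `C` have a distance greater than `s`. -/
def IsSeparated {V : Type} (G : SimpleGraph V) (s : ℕ) (C : V → Prop) : Prop :=
  ∀ u v, C u → C v → u ∈ nodeBall G s v → u = v

/-- Every node is within distance `D` of a node of `C`. -/
def IsDominating {V : Type} (G : SimpleGraph V) (D : ℕ) (C : V → Prop) : Prop :=
  ∀ v, ∃ u ∈ nodeBall G D v, C u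

theorem IsSeparated.mono {V : Type} {G : SimpleGraph V} {s t : ℕ} {C C' : V → Prop}
    (h : IsSeparated G t C) (hst : s ≤ t) (hC : ∀ v, C' v → C v) : IsSeparated G s C' :=
  fun u v hu hv huv => h u v (hC u hu) (hC v hv) (nodeBall_subset_nodeBall hst huv)

/-- The nodes of `C` that remain when those with the bit `true` give way to those with the bit
`false` within distance `s`. -/
def bitStep {V : Type} (G : SimpleGraph V) (s : ℕ) (C : V → Prop) (bit : V → Bool) (v : V) : Prop :=
  C v ∧ (bit v = true → ∀ u ∈ nodeBall G s v, C u → bit u = true)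

section BitStep

variable {V : Type} {G : SimpleGraph V} {s D : ℕ} {C : V → Prop} {bit : V → Bool} {u v : V}

theorem bitStep_bit_eq (hu : bitStep G s C bit u) (hv : bitStep G s C bit v)
    (h : u ∈ nodeBall G s v) : bit u = bit v := by
  rw [Bool.eq_iff_iff]
  exact ⟨fun hbit => hu.2 hbit v (mem_nodeBall_comm.1 h) hv.1, fun hbit => hv.2 hbit u h hu.1⟩

theorem IsDominating.bitStep (h : IsDominating G D C) :
    IsDominating G (D + s) (bitStep G s C bit) := by
  intro v
  obtain ⟨u, hu, hCu⟩ := h v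
  by_cases hex : ∃ w ∈ nodeBall G s u, C w ∧ bit w = false
  · obtain ⟨w, hw, hCw, hbit⟩ := hex
    exact ⟨w, mem_nodeBall_trans hu hw, hCw, by simp [hbit]⟩
  · refine ⟨u, nodeBall_subset_nodeBall (D.le_add_right s) hu, hCu, fun _ w hw hCw => ?_⟩
    by_contra hbit
    exact hex ⟨w, hw, hCw, Bool.eq_false_of_not_eq_true hbit⟩

end BitStep

section Local

variable {c n Δ R : ℕ} {excl : Prop}

theorem IsLocal.exists_mem_nodeBall {P : NodeFun c n Δ excl Prop} (h : IsLocal R P) (s : ℕ) :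
    IsLocal (R + s) fun N v => ∃ u ∈ nodeBall N.G s v, P N u :=
  ((h.image_nodeBall s).map fun S => True ∈ S).congr fun N v => by simp

theorem IsLocal.forall_mem_nodeBall {P : NodeFun c n Δ excl Prop} (h : IsLocal R P) (s : ℕ) :
    IsLocal (R + s) fun N v => ∀ u ∈ nodeBall N.G s v, P N u :=
  ((h.image_nodeBall s).map fun S => False ∉ S).congr fun N v => by simp

theorem IsLocal.bitStep {C : NodeFun c n Δ excl Prop} {bit : NodeFun c n Δ excl Bool}
    (hC : IsLocal R C) (hbit : IsLocal R bit) (s : ℕ) :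
    IsLocal (R + s) fun N v => bitStep N.G s (C N) (bit N) v :=
  ((hC.prodMk hbit).mono (R.le_add_right s)).map₂
    ((hC.map₂ hbit fun c b => c → b = true).forall_mem_nodeBall s)
    fun y all => y.1 ∧ (y.2 = true → all)

theorem exists_rulingSet {s b : ℕ} {col : NodeFun c n Δ excl ℕ} (hcol : IsLocal R col)
    (hpower : ∀ N, IsPowerColoring N.G s (2 ^ b) (col N)) :
    ∃ C : NodeFun c n Δ excl Prop, IsLocal (R + b * s) C ∧
      ∀ N, IsSeparated N.G s (C N) ∧ IsDominating N.G (b * s) (C N) := by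
  suffices hbits : ∀ i, ∃ C : NodeFun c n Δ excl Prop, IsLocal (R + i * s) C ∧
      ∀ N, (∀ u v, C N u → C N v → u ∈ nodeBall N.G s v → ∀ j < i,
        (col N u).testBit j = (col N v).testBit j) ∧ IsDominating N.G (i * s) (C N) by
    obtain ⟨C, hC, hspec⟩ := hbits b
    refine ⟨C, hC, fun N => ⟨fun u v hu hv huv => ?_, (hspec N).2⟩⟩
    by_contra hne
    refine (hpower N).2 u v hne huv (Nat.eq_of_testBit_eq fun j => ?_)
    obtain hj | hj := lt_or_ge j b
    · exact (hspec N).1 u v hu hv huv j hj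
    · have hlt : ∀ w, col N w < 2 ^ j := fun w =>
        ((hpower N).1 w).trans_le (Nat.pow_le_pow_right two_pos hj)
      rw [Nat.testBit_lt_two_pow (hlt u), Nat.testBit_lt_two_pow (hlt v)]
  intro i
  induction i with
  | zero =>
    exact ⟨fun _ _ => True, isLocal_const _ _, fun N => ⟨by simp,
      fun v => ⟨v, mem_nodeBall_self _ _, trivial⟩⟩⟩
  | succ i ih =>
    obtain ⟨C, hC, hspec⟩ := ih
    let bit : NodeFun c n Δ excl Bool := fun N v => (col N v).testBit i
    have hbit : IsLocal (R + i * s) bit := (hcol.mono (by omega)).map fun a => a.testBit i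
    rw [Nat.succ_mul, ← Nat.add_assoc]
    refine ⟨_, hC.bitStep hbit s, fun N => ⟨fun u v hu hv huv j hj => ?_, (hspec N).2.bitStep⟩⟩
    obtain hj | rfl := Nat.lt_succ_iff_lt_or_eq.1 hj
    · exact (hspec N).1 u v hu.1 hv.1 huv j hj
    · exact bitStep_bit_eq hu hv huv

/-! ### Labels -/

theorem isLocal_ncard_nodeBall (r : ℕ) :
    IsLocal r fun (N : Network c n Δ excl) v => (nodeBall N.G r v).ncard := by
  have hids := (isLocal_ident (c := c) (n := n) (Δ := Δ) (excl := excl) 0).image_nodeBall r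
  rw [Nat.zero_add] at hids
  exact (hids.map Set.ncard).congr fun N v =>
    (Set.ncard_image_of_injective _ N.isNetwork.ident_injective).symm

theorem IsLocal.exists_dispatch {β : Type} [Nonempty β] {r : ℕ} {center : NodeFun c n Δ excl Prop}
    {plan : NodeFun c n Δ excl (ℕ → β)} {f : NodeFun c n Δ excl β} (hcenter : IsLocal R center)
    (hplan : IsLocal R plan) (hf : IsLocal R f)
    (hsep : ∀ N, IsSeparated N.G (2 * r) (center N)) :
    ∃ g : NodeFun c n Δ excl β, IsLocal (R + r) g ∧
      ∀ N u, (∀ v, center N v → u ∈ nodeBall N.G r v → g N u = plan N v (N.ident u)) ∧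
        ((∀ v, center N v → u ∉ nodeBall N.G r v) → g N u = f N u) := by
  let plans : NodeFun c n Δ excl (Set (Prop × (ℕ → β))) := fun N u =>
    (fun v => (center N v, plan N v)) '' nodeBall N.G r u
  have hplans : IsLocal (R + r) plans := (hcenter.prodMk hplan).image_nodeBall r
  have hmem : ∀ N u p, (True, p) ∈ plans N u ↔
      ∃ v, center N v ∧ u ∈ nodeBall N.G r v ∧ plan N v = p := by
    intro N u p
    simp only [plans, Set.mem_image, Prod.mk.injEq, eq_iff_iff, iff_true,
      mem_nodeBall_comm (u := u)]
    exact exists_congr fun v => and_left_comm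
  let IsValue (i : ℕ) (b₀ : β) (S : Set (Prop × (ℕ → β))) (b : β) : Prop :=
    (∀ p, (True, p) ∈ S → b = p i) ∧ ((∀ p, (True, p) ∉ S) → b = b₀)
  have hexists : ∀ N u, ∃ b, IsValue (N.ident u) (f N u) (plans N u) b := by
    intro N u
    by_cases h : ∃ v, center N v ∧ u ∈ nodeBall N.G r v
    · obtain ⟨v, hv, huv⟩ := h
      refine ⟨plan N v (N.ident u), fun p hp => ?_, fun h =>
        absurd ((hmem N u _).2 ⟨v, hv, huv, rfl⟩) (h _)⟩
      obtain ⟨v', hv', huv', rfl⟩ := (hmem N u p).1 hp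
      rw [hsep N v' v hv' hv (two_mul r ▸ mem_nodeBall_trans huv (mem_nodeBall_comm.1 huv'))]
    · refine ⟨f N u, fun p hp => ?_, fun _ => rfl⟩
      obtain ⟨v, hv, huv, -⟩ := (hmem N u p).1 hp
      exact absurd ⟨v, hv, huv⟩ h
  refine ⟨fun N u => Classical.epsilon (IsValue (N.ident u) (f N u) (plans N u)),
    ((isLocal_ident _).prodMk (hf.mono (R.le_add_right r))).map₂ hplans
      fun y S => Classical.epsilon (IsValue y.1 y.2 S),
    fun N u => ⟨fun v hv huv => ?_, fun h => ?_⟩⟩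
  · exact (Classical.epsilon_spec (hexists N u)).1 _ ((hmem N u _).2 ⟨v, hv, huv, rfl⟩)
  · refine (Classical.epsilon_spec (hexists N u)).2 fun p hp => ?_
    obtain ⟨v, hv, huv, -⟩ := (hmem N u p).1 hp
    exact h v hv huv

theorem exists_surjOn_of_encard_le {α β : Type*} [Nonempty β] {s : Set β} {t : Set α}
    (hs : s.Finite) (h : s.encard ≤ t.encard) : ∃ f : α → β, Set.SurjOn f t s := by
  obtain rfl | hne := s.eq_empty_or_nonempty
  · exact ⟨fun _ => Classical.arbitrary β, Set.surjOn_empty _ _⟩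
  have : Nonempty α := by
    have hpos := (Set.encard_pos.2 hne).trans_le h
    exact (Set.encard_pos.1 hpos).to_type
  obtain ⟨f, hf, hinj⟩ := hs.exists_injOn_of_encard_le h
  exact ⟨Function.invFunOn f s, hinj.leftInvOn_invFunOn.surjOn hf⟩

theorem exists_labels {r q : ℕ} {C : NodeFun c n Δ excl Prop} (hC : IsLocal R C)
    (hsep : ∀ N, IsSeparated N.G (2 * r) (C N)) :
    ∃ lab : NodeFun c n Δ excl ℕ, IsLocal (R + 2 * r) lab ∧ ∀ N v, C N v →
      q ≤ (nodeBall N.G r v).ncard → Set.SurjOn (lab N) (nodeBall N.G r v) (Set.Iio q) := by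
  let rich : NodeFun c n Δ excl Prop := fun N v => C N v ∧ q ≤ (nodeBall N.G r v).ncard
  let IsPlan (ids : Set ℕ) (e : ℕ → ℕ) : Prop := Set.SurjOn e ids (Set.Iio q)
  let plan : NodeFun c n Δ excl (ℕ → ℕ) := fun N v =>
    Classical.epsilon (IsPlan (N.ident '' nodeBall N.G r v))
  have hrich : IsLocal (R + r) rich := (hC.mono (R.le_add_right r)).map₂
    ((isLocal_ncard_nodeBall r).mono (Nat.le_add_left r R)) fun c m => c ∧ q ≤ m
  have hplan : IsLocal (R + r) plan :=
    ((isLocal_ident R).image_nodeBall r).map fun ids => Classical.epsilon (IsPlan ids)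
  obtain ⟨lab, hlab, hspec⟩ := hrich.exists_dispatch hplan (isLocal_const _ 0)
    fun N => (hsep N).mono le_rfl fun v hv => hv.1
  refine ⟨lab, by rwa [two_mul, ← Nat.add_assoc], fun N v hv hq i hi => ?_⟩
  have hencard : (Set.Iio q).encard ≤ (N.ident '' nodeBall N.G r v).encard := by
    rw [N.isNetwork.ident_injective.encard_image, ← Finset.coe_range,
      Set.encard_coe_eq_coe_finsetCard, Finset.card_range,
      ← (Set.toFinite (nodeBall N.G r v)).cast_ncard_eq]
    exact_mod_cast hq
  have hsurj : IsPlan _ (plan N v) := Classical.epsilon_spec (p := IsPlan _)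
    (exists_surjOn_of_encard_le (Set.finite_Iio q) hencard)
  obtain ⟨_, ⟨u, hu, rfl⟩, hui⟩ := hsurj hi
  exact ⟨u, hu, ((hspec N u).1 v ⟨hv, hq⟩ hu).trans hui⟩

/-! ### The distance to a sink -/

/-- The distance from `v` to the nearest sink; it is `0` if there is none. -/
noncomputable def distTo {V : Type} (G : SimpleGraph V) (sink : V → Prop) (v : V) : ℕ :=
  sInf {t | ∃ u ∈ nodeBall G t v, sink u}

section DistTo

variable {V : Type} {G : SimpleGraph V} {sink : V → Prop} {D : ℕ} {v : V}

theorem IsDominating.distTo_le (h : IsDominating G D sink) : distTo G sink v ≤ D :=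
  Nat.sInf_le (h v)

theorem IsDominating.distTo_eq_zero_iff (h : IsDominating G D sink) :
    distTo G sink v = 0 ↔ sink v := by
  have hne : {t | ∃ u ∈ nodeBall G t v, sink u} ≠ ∅ := Set.Nonempty.ne_empty ⟨D, h v⟩
  simp [distTo, Nat.sInf_eq_zero, hne, nodeBall_zero]

theorem exists_adj_distTo_lt (h : distTo G sink v ≠ 0) :
    ∃ u, G.Adj v u ∧ distTo G sink u < distTo G sink v := by
  obtain ⟨t, ht⟩ := Nat.exists_eq_succ_of_ne_zero h
  obtain ⟨w, hw, hsink⟩ := Nat.sInf_mem (Nat.nonempty_of_sInf_eq_succ ht)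
  change w ∈ nodeBall G (distTo G sink v) v at hw
  rw [ht] at hw ⊢
  obtain hw | ⟨u, hvu, hw⟩ := mem_nodeBall_succ.1 hw
  · exact absurd (Nat.sInf_le (s := {t | ∃ u ∈ nodeBall G t v, sink u}) ⟨w, hw, hsink⟩)
      (not_le.2 (ht ▸ t.lt_succ_self : t < distTo G sink v))
  · exact ⟨u, hvu, Nat.lt_succ_of_le (Nat.sInf_le ⟨w, hw, hsink⟩)⟩

end DistTo

theorem IsLocal.distTo {D : ℕ} {sink : NodeFun c n Δ excl Prop} (hsink : IsLocal R sink)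
    (hD : ∀ N, IsDominating N.G D (sink N)) :
    IsLocal (R + D) fun N v => distTo N.G (sink N) v := by
  have hball : ∀ t, IsLocal (R + D) fun N v => ∃ u ∈ nodeBall N.G (min t D) v, sink N u :=
    fun t => (hsink.exists_mem_nodeBall _).mono (Nat.add_le_add_left (min_le_right t D) R)
  refine ((IsLocal.pi hball).map fun S => sInf {t | S t}).congr fun N v => congrArg sInf ?_
  ext t
  obtain ht | ht := le_total t D
  · simp [min_eq_left ht]
  · obtain ⟨u, hu, hs⟩ := hD N v
    simpa [min_eq_right ht, hD N v] using ⟨u, nodeBall_subset_nodeBall ht hu, hs⟩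

end Local

/-! ### Coloring in the order of a schedule -/

section Schedule

variable {V : Type} {G : SimpleGraph V} {Δ j : ℕ} {τ f g : V → ℕ} {v : V}

open Classical in
/-- The list of `v` when the nodes with `τ v = j` are colored, and the nodes with a smaller value of
`τ` have already received the colors `f`. The other nodes are isolated then; as the list coloring
algorithm runs on them too, they get all colors. -/
noncomputable def availableColors (G : SimpleGraph V) (Δ : ℕ) (τ f : V → ℕ) (j : ℕ) (v : V) :
    Finset ℕ :=
  {a ∈ Finset.Icc 1 Δ | τ v = j → ∀ u, G.Adj v u → τ u < j → f u ≠ a}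

theorem mem_availableColors {a : ℕ} : a ∈ availableColors G Δ τ f j v ↔
    a ∈ Finset.Icc 1 Δ ∧ (τ v = j → ∀ u, G.Adj v u → τ u < j → f u ≠ a) := by
  simp only [availableColors, Finset.mem_filter]

theorem ncard_neighborSet_activeGraph_add_le [Finite V] (hdeg : (G.neighborSet v).ncard ≤ Δ)
    (hlater : ∃ w, G.Adj v w ∧ j < τ w) :
    ((activeGraph G fun u => τ u = j).neighborSet v).ncard + {u | G.Adj v u ∧ τ u < j}.ncard + 1 ≤
      Δ := by
  obtain ⟨w, hvw, hw⟩ := hlater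
  set same := (activeGraph G fun u => τ u = j).neighborSet v
  set earlier := {u | G.Adj v u ∧ τ u < j}
  have hsame : ∀ u ∈ same, τ u = j := fun u hu => hu.2.2
  have hearlier : ∀ u ∈ earlier, τ u < j := fun u hu => hu.2
  have hdisj : Disjoint same earlier :=
    Set.disjoint_left.2 fun u hu hu' => (hearlier u hu').ne (hsame u hu)
  have hnotMem : w ∉ same ∪ earlier := by
    rintro (h | h)
    · exact hw.ne' (hsame w h)
    · exact hw.not_gt (hearlier w h)
  have hsub : insert w (same ∪ earlier) ⊆ G.neighborSet v := by
    rintro u (rfl | hu | hu)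
    exacts [hvw, hu.1, hu.1]
  rw [← Set.ncard_union_eq hdisj (Set.toFinite _) (Set.toFinite _),
    ← Set.ncard_insert_of_notMem hnotMem (Set.toFinite _)]
  exact (Set.ncard_le_ncard hsub (Set.toFinite _)).trans hdeg

theorem degree_add_one_le_card_availableColors [Fintype V] (hΔ : 1 ≤ Δ)
    (hdeg : (G.neighborSet v).ncard ≤ Δ) (hlater : τ v = j → ∃ w, G.Adj v w ∧ j < τ w) :
    (activeGraph G fun u => τ u = j).degree v + 1 ≤ (availableColors G Δ τ f j v).card := by
  rw [degree_eq_ncard]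
  by_cases hv : τ v = j
  · have hcount := ncard_neighborSet_activeGraph_add_le hdeg (hlater hv)
    set earlier := {u | G.Adj v u ∧ τ u < j}
    have hcover : (Finset.Icc 1 Δ : Set ℕ) ⊆ availableColors G Δ τ f j v ∪ f '' earlier := by
      intro a ha
      by_cases hused : ∃ u ∈ earlier, f u = a
      · exact Or.inr hused
      · exact Or.inl (mem_availableColors.2 ⟨ha, fun _ u hvu hu hua => hused ⟨u, ⟨hvu, hu⟩, hua⟩⟩)
    have hΔle := (Set.ncard_le_ncard hcover (Set.toFinite _)).trans (Set.ncard_union_le _ _)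
    rw [Set.ncard_coe_finset, Set.ncard_coe_finset, Nat.card_Icc] at hΔle
    have himage := Set.ncard_image_le (f := f) (Set.toFinite earlier)
    omega
  · have hisolated : (activeGraph G fun u => τ u = j).neighborSet v = ∅ :=
      Set.eq_empty_of_forall_notMem fun u hu => hv hu.2.1
    simpa [hisolated, availableColors, hv] using hΔ

open Classical in
theorem IsProperColoring.extend
    (hf : IsProperColoring (activeGraph G fun v => τ v < j) Δ f)
    (hg : IsListColoring (activeGraph G fun v => τ v = j) (availableColors G Δ τ f j) g) :
    IsProperColoring (activeGraph G fun v => τ v < j + 1) Δ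
      fun v => if τ v = j then g v else f v := by
  have hmem : ∀ v, τ v = j → ∀ u, G.Adj v u → τ u < j → f u ≠ g v := fun v =>
    (mem_availableColors.1 (hg.1 v)).2
  refine ⟨fun v => ?_, fun u v ⟨huv, hu, hv⟩ => ?_⟩
  · dsimp only
    split_ifs
    · exact (mem_availableColors.1 (hg.1 v)).1
    · exact hf.1 v
  · dsimp only
    split_ifs with hu' hv' hv'
    · exact hg.2 u v ⟨huv, hu', hv'⟩
    · exact (hmem u hu' v huv (by omega)).symm
    · exact hmem v hv' u huv.symm (by omega)
    · exact hf.2 u v ⟨huv, by omega, by omega⟩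

end Schedule

section Local

variable {c n Δ R : ℕ} {excl : Prop}

theorem IsLocal.availableColors {τ f : NodeFun c n Δ excl ℕ} (hτ : IsLocal R τ) (hf : IsLocal R f)
    (j : ℕ) : IsLocal (R + 1) fun N v => availableColors N.G Δ (τ N) (f N) j v := by
  classical
  refine (hτ.succ.map₂ (hτ.prodMk hf).image_neighborSet fun t S =>
    {a ∈ Finset.Icc 1 Δ | t = j → ∀ t' < j, (t', a) ∉ S}).congr fun N v => ?_
  ext a
  simp only [mem_availableColors, Finset.mem_filter, Set.mem_image, Prod.mk.injEq, not_exists,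
    not_and, SimpleGraph.mem_neighborSet]
  grind

theorem Network.isNetwork_activeGraph (N : Network c n Δ excl) (act : N.V → Prop) :
    IsNetwork c n Δ (activeGraph N.G act) N.ident where
  card_eq := N.isNetwork.card_eq
  maxDegree_le := by
    refine SimpleGraph.maxDegree_le_of_forall_degree_le _ _ fun v => ?_
    rw [degree_eq_ncard]
    exact (Set.ncard_le_ncard (fun u hu => hu.1) (Set.toFinite _)).trans (N.ncard_neighborSet_le v)
  ident_mem := N.isNetwork.ident_mem
  ident_injective := N.isNetwork.ident_injective

/-- Greedy coloring with `Δ` colors: a node with a later neighbor has at most `Δ - 1` neighbors that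
are colored before it or together with it. -/
theorem exists_scheduledColoring {m T J : ℕ} (hΔ : 1 ≤ Δ) (hA : ListColoringInTime c m n Δ T)
    {τ col : NodeFun c n Δ excl ℕ} (hτ : IsLocal R τ) (hcol : IsLocal R col)
    (hproper : ∀ N j, IsProperColoring (activeGraph N.G fun v => τ N v = j) m (col N))
    (hlater : ∀ N v, τ N v < J → ∃ u, N.G.Adj v u ∧ τ N v < τ N u) :
    ∃ f : NodeFun c n Δ excl ℕ, IsLocal (R + J * (T + 2)) f ∧
      ∀ N, IsProperColoring (activeGraph N.G fun v => τ N v < J) Δ (f N) := by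
  classical
  obtain ⟨A, hA⟩ := hA
  induction J with
  | zero =>
    exact ⟨fun _ _ => 1, isLocal_const _ _, fun N =>
      ⟨fun _ => Finset.left_mem_Icc.2 hΔ, fun u v huv => absurd huv.2.1 (Nat.not_lt_zero _)⟩⟩
  | succ j ih =>
    obtain ⟨f, hf, hcolors⟩ := ih fun N v hv => hlater N v (by omega)
    let input : NodeFun c n Δ excl (ℕ × Finset ℕ) := fun N v =>
      (col N v, availableColors N.G Δ (τ N) (f N) j v)
    let g : NodeFun c n Δ excl ℕ := fun N =>
      A.run n Δ (activeGraph N.G fun v => τ N v = j) N.ident (input N) T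
    have hτ' : IsLocal (R + j * (T + 2)) τ := hτ.mono (by omega)
    have hg : IsLocal (R + (j + 1) * (T + 2)) g := by
      have hinput : IsLocal (R + j * (T + 2) + 1) input :=
        (hcol.mono (by omega)).prodMk (hτ'.availableColors hf j)
      exact ((hτ'.succ.map (· = j)).run A hinput T).mono (by rw [Nat.succ_mul]; omega)
    have hle : R + j * (T + 2) ≤ R + (j + 1) * (T + 2) := by gcongr; omega
    refine ⟨fun N v => if τ N v = j then g N v else f N v,
      ((hτ'.mono hle).prodMk hg).map₂ (hf.mono hle) fun y a => if y.1 = j then y.2 else a,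
      fun N => (hcolors N).extend ?_⟩
    exact hA N.V _ N.ident (col N) _ (N.isNetwork_activeGraph _) (hproper N j) fun v =>
      degree_add_one_le_card_availableColors hΔ (N.ncard_neighborSet_le v)
        fun hv => hv ▸ hlater N v (by omega)

/-! ### Filling the holes -/

/-- If the nodes in the ball of radius `r` around `v` take the colors `ψ`, which are indexed by
identifiers, then there are no conflicts at these nodes, except with nodes that are dead. On the
nodes around the ball, `ψ` agrees with the present coloring `f`. -/
def IsFilling (N : Network c n Δ excl) (dead : N.V → Prop) (f : N.V → ℕ) (r : ℕ) (v : N.V)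
    (ψ : ℕ → ℕ) : Prop :=
  (∀ u ∈ nodeBall N.G r v, ψ (N.ident u) ∈ Finset.Icc 1 Δ ∧
      ∀ w, (activeGraph N.G fun u => ¬ dead u).Adj u w → ψ (N.ident u) ≠ ψ (N.ident w)) ∧
    ∀ u ∈ nodeBall N.G (r + 1) v, u ∉ nodeBall N.G r v → ψ (N.ident u) = f u

theorem IsLocal.isFilling {dead : NodeFun c n Δ excl Prop} {f : NodeFun c n Δ excl ℕ}
    (hdead : IsLocal R dead) (hf : IsLocal R f) (r : ℕ) (ψ : ℕ → ℕ) :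
    IsLocal (R + 1 + r) fun N v => IsFilling N (dead N) (f N) r v ψ := by
  have hlive := (hdead.map Not).prodMk (isLocal_ident R)
  have hinner : IsLocal (R + 1) fun N u => ψ (N.ident u) ∈ Finset.Icc 1 Δ ∧
      ∀ w, (activeGraph N.G fun u => ¬ dead N u).Adj u w → ψ (N.ident u) ≠ ψ (N.ident w) := by
    refine (hlive.succ.map₂ hlive.image_neighborSet fun x S => ψ x.2 ∈ Finset.Icc 1 Δ ∧
      ∀ i, x.1 → (True, i) ∈ S → ψ x.2 ≠ ψ i).congr fun N u => ?_
    simp only [activeGraph, Set.mem_image, SimpleGraph.mem_neighborSet, Prod.mk.injEq, eq_iff_iff,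
      iff_true]
    grind
  have hids := ((isLocal_ident (c := c) (n := n) (Δ := Δ) (excl := excl) R).image_nodeBall r).mono
    (show R + r ≤ R + 1 + r by omega)
  have hcolors := (((isLocal_ident R).prodMk hf).image_nodeBall (r + 1)).mono
    (show R + (r + 1) ≤ R + 1 + r by omega)
  have houter : IsLocal (R + 1 + r) fun N v => ∀ u ∈ nodeBall N.G (r + 1) v,
      u ∉ nodeBall N.G r v → ψ (N.ident u) = f N u := by
    refine (hids.map₂ hcolors fun ids S => ∀ x ∈ S, x.1 ∉ ids → ψ x.1 = x.2).congr fun N v => ?_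
    simp only [Set.forall_mem_image, N.isNetwork.ident_injective.mem_set_image]
  exact (hinner.forall_mem_nodeBall r).map₂ houter And

theorem exists_isFilling {r q : ℕ} (hΔ : 3 ≤ Δ) (hq : 2 ≤ q) (hexcl : Δ + 2 ≤ q → excl)
    (hr : 4 * Nat.clog Δ q ≤ r) (N : Network c n Δ excl) {f : N.V → ℕ} {dead poor : N.V → Prop}
    (hsep : IsSeparated N.G (2 * r + 1) poor)
    (hf : IsProperColoring (activeGraph N.G fun v => ¬ dead v ∧ ¬ poor v) Δ f) {v : N.V}
    (hv : poor v) (hsmall : (nodeBall N.G r v).ncard < q) : ∃ ψ, IsFilling N dead f r v ψ := by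
  set H := activeGraph N.G fun u => ¬ dead u ∧ (poor u → u = v)
  have hH : H ≤ N.G := activeGraph_le _ _
  obtain ⟨ψ, hψ, hψf⟩ := exists_recoloring (H := H) (c := v) (φ := f) hΔ
    (fun u => (Set.ncard_le_ncard (fun w hw => hw.1) (Set.toFinite _)).trans
      (N.ncard_neighborSet_le u)) hq (fun h => (N.cliqueFree (hexcl h)).anti hH) hr
    ((Set.ncard_le_ncard (nodeBall_mono hH) (Set.toFinite _)).trans_lt hsmall) hf.1
    fun u w hu hw huw => hf.2 u w
      ⟨huw.1, ⟨huw.2.1.1, fun h => hu (huw.2.1.2 h)⟩, huw.2.2.1, fun h => hw (huw.2.2.2 h)⟩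
  have honly : ∀ u ∈ nodeBall N.G (r + 1) v, poor u → u = v := fun u hu hpoor =>
    hsep u v hpoor hv (nodeBall_subset_nodeBall (by omega) hu)
  refine ⟨Function.extend N.ident ψ 0, ?_⟩
  simp only [IsFilling, N.isNetwork.ident_injective.extend_apply]
  refine ⟨fun u hu => ⟨hψ.1 u, fun w huw => hψ.2 u w ⟨huw.1, ?_, ?_⟩⟩, fun u _ hu =>
    hψf fun h => hu (nodeBall_mono hH h)⟩
  · exact ⟨huw.2.1, honly u (nodeBall_subset_nodeBall r.le_succ hu)⟩
  · exact ⟨huw.2.2, honly w (mem_nodeBall_trans hu (mem_nodeBall_of_adj huw.1))⟩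

/-- As the balls of two poor nodes are not adjacent, the plan of a poor node is followed not only in
its ball, but also around it. -/
theorem isProperColoring_of_isFilling {r : ℕ} {N : Network c n Δ excl} {f g : N.V → ℕ}
    {dead poor : N.V → Prop} {ψ : N.V → ℕ → ℕ} (hsep : IsSeparated N.G (2 * r + 1) poor)
    (hf : IsProperColoring (activeGraph N.G fun v => ¬ dead v ∧ ¬ poor v) Δ f)
    (hψ : ∀ v, poor v → IsFilling N dead f r v (ψ v))
    (hin : ∀ u v, poor v → u ∈ nodeBall N.G r v → g u = ψ v (N.ident u))
    (hout : ∀ u, (∀ v, poor v → u ∉ nodeBall N.G r v) → g u = f u) :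
    IsProperColoring (activeGraph N.G fun v => ¬ dead v) Δ g := by
  have haround : ∀ u v, poor v → u ∈ nodeBall N.G (r + 1) v → g u = ψ v (N.ident u) := by
    intro u v hv hu
    by_cases hur : u ∈ nodeBall N.G r v
    · exact hin u v hv hur
    · rw [(hψ v hv).2 u hu hur]
      refine hout u fun v' hv' hu' => hur ?_
      have hvv' := mem_nodeBall_trans hu (mem_nodeBall_comm.1 hu')
      rwa [← hsep v' v hv' hv (nodeBall_subset_nodeBall (by omega) hvv')]
  have hball : ∀ u w v, (activeGraph N.G fun v => ¬ dead v).Adj u w → poor v →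
      u ∈ nodeBall N.G r v → g u ≠ g w := fun u w v huw hv hu => by
    rw [hin u v hv hu, haround w v hv (mem_nodeBall_trans hu (mem_nodeBall_of_adj huw.1))]
    exact ((hψ v hv).1 u hu).2 w huw
  refine ⟨fun u => ?_, fun u w huw => ?_⟩
  · by_cases hu : ∃ v, poor v ∧ u ∈ nodeBall N.G r v
    · obtain ⟨v, hv, huv⟩ := hu
      exact hin u v hv huv ▸ ((hψ v hv).1 u huv).1
    · exact hout u (fun v hv huv => hu ⟨v, hv, huv⟩) ▸ hf.1 u
  · by_cases hu : ∃ v, poor v ∧ u ∈ nodeBall N.G r v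
    · obtain ⟨v, hv, huv⟩ := hu
      exact hball u w v huw hv huv
    by_cases hw : ∃ v, poor v ∧ w ∈ nodeBall N.G r v
    · obtain ⟨v, hv, hwv⟩ := hw
      exact (hball w u v huw.symm hv hwv).symm
    push Not at hu hw
    rw [hout u hu, hout w hw]
    exact hf.2 u w ⟨huw.1, ⟨huw.2.1, fun h => hu u h (mem_nodeBall_self _ _)⟩,
      huw.2.2, fun h => hw w h (mem_nodeBall_self _ _)⟩

theorem exists_filledColoring {r q : ℕ} (hΔ : 3 ≤ Δ) (hq : 2 ≤ q) (hexcl : Δ + 2 ≤ q → excl)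
    (hr : 4 * Nat.clog Δ q ≤ r) {f : NodeFun c n Δ excl ℕ} {dead poor : NodeFun c n Δ excl Prop}
    (hf : IsLocal R f) (hdead : IsLocal R dead) (hpoor : IsLocal R poor)
    (hsep : ∀ N, IsSeparated N.G (2 * r + 1) (poor N))
    (hsmall : ∀ N v, poor N v → (nodeBall N.G r v).ncard < q)
    (hproper : ∀ N, IsProperColoring (activeGraph N.G fun v => ¬ dead N v ∧ ¬ poor N v) Δ (f N)) :
    ∃ g : NodeFun c n Δ excl ℕ, IsLocal (R + (2 * r + 1)) g ∧
      ∀ N, IsProperColoring (activeGraph N.G fun v => ¬ dead N v) Δ (g N) := by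
  let plan : NodeFun c n Δ excl (ℕ → ℕ) := fun N v =>
    Classical.epsilon (IsFilling N (dead N) (f N) r v)
  have hplan : IsLocal (R + 1 + r) plan :=
    (IsLocal.pi fun ψ => hdead.isFilling hf r ψ).map Classical.epsilon
  obtain ⟨g, hg, hspec⟩ := (hpoor.mono (by omega : R ≤ R + 1 + r)).exists_dispatch hplan
    (hf.mono (by omega)) fun N => (hsep N).mono (2 * r).le_succ fun _ => id
  have hfilling : ∀ N v, poor N v → IsFilling N (dead N) (f N) r v (plan N v) := fun N v hv =>
    Classical.epsilon_spec
      (exists_isFilling hΔ hq hexcl hr N (hsep N) (hproper N) hv (hsmall N v hv))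
  exact ⟨g, hg.mono (by omega), fun N => isProperColoring_of_isFilling (hsep N) (hproper N)
    (hfilling N) (fun u => (hspec N u).1) fun u => (hspec N u).2⟩

end Local

/-! ### The multicoloring -/

theorem block_injective {Δ i j x y : ℕ} (hx : x ∈ Finset.Icc 1 Δ) (hy : y ∈ Finset.Icc 1 Δ)
    (h : i * Δ + x = j * Δ + y) : i = j ∧ x = y := by
  have hblock : ∀ {k z : ℕ}, z ∈ Finset.Icc 1 Δ → (k * Δ + z - 1) / Δ = k := fun {k z} hz => by
    rw [Finset.mem_Icc] at hz
    refine Nat.div_eq_of_lt_le ?_ ?_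
    · omega
    · rw [Nat.succ_mul]
      omega
  obtain rfl : i = j := by rw [← hblock (k := i) hx, h, hblock hy]
  exact ⟨rfl, Nat.add_left_cancel h⟩

theorem isMulticoloring_blocks {V : Type} {G : SimpleGraph V} {q Δ : ℕ} {lab : V → ℕ}
    {g : ℕ → V → ℕ} (hg : ∀ i < q, IsProperColoring (activeGraph G fun v => lab v ≠ i) Δ (g i)) :
    IsMulticoloring G (q * Δ) (q - 1) fun v =>
      ((Finset.range q).erase (lab v)).image fun i => i * Δ + g i v := by
  have hlt : ∀ {i v}, i ∈ (Finset.range q).erase (lab v) → i < q := fun hi =>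
    Finset.mem_range.1 (Finset.mem_of_mem_erase hi)
  refine ⟨fun v x hx => ?_, fun v => ?_, fun u v huv => Finset.disjoint_left.2 fun x hu hv => ?_⟩
  · obtain ⟨i, hi, rfl⟩ := Finset.mem_image.1 hx
    have hcolor := Finset.mem_Icc.1 ((hg i (hlt hi)).1 v)
    have hend : (i + 1) * Δ ≤ q * Δ := Nat.mul_le_mul_right Δ (hlt hi)
    rw [Nat.succ_mul] at hend
    rw [Finset.mem_Icc]
    omega
  · rw [Finset.card_image_of_injOn fun i hi j hj h =>
      (block_injective ((hg i (hlt hi)).1 v) ((hg j (hlt hj)).1 v) h).1]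
    simpa only [Finset.card_range] using
      Finset.pred_card_le_card_erase (s := Finset.range q) (a := lab v)
  · obtain ⟨i, hi, rfl⟩ := Finset.mem_image.1 hu
    obtain ⟨j, hj, h⟩ := Finset.mem_image.1 hv
    obtain ⟨rfl, hcolor⟩ := block_injective ((hg j (hlt hj)).1 v) ((hg i (hlt hi)).1 u) h
    exact (hg j (hlt hj)).2 u v ⟨huv, (Finset.ne_of_mem_erase hi).symm,
      (Finset.ne_of_mem_erase hj).symm⟩ hcolor.symm

/-- The number of bits of the colors in a coloring of the `s`-th power of a network. -/
def colorBits (c Δ s : ℕ) : ℕ :=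
  6 + 2 * Nat.clog 2 (lengthConst c) + 2 * s * Nat.clog 2 (Δ + 1)

theorem powerColors_le_two_pow (c Δ s : ℕ) :
    64 * (lengthConst c * (Δ + 1) ^ s) ^ 2 ≤ 2 ^ colorBits c Δ s := by
  have hconst := Nat.le_pow_clog one_lt_two (lengthConst c)
  have hdegree := Nat.le_pow_clog one_lt_two (Δ + 1)
  calc 64 * (lengthConst c * (Δ + 1) ^ s) ^ 2
      ≤ 64 * (2 ^ Nat.clog 2 (lengthConst c) * (2 ^ Nat.clog 2 (Δ + 1)) ^ s) ^ 2 := by gcongr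
    _ = 2 ^ colorBits c Δ s := by
        rw [colorBits, pow_add, pow_add]
        norm_num
        ring

/-- The number of classes into which a coloring of a network is split, so that each class has at
most `C * Δ ^ 2` colors, as many as the given coloring in the list coloring problem. -/
def classCount (c : ℕ) : ℕ := 256 * lengthConst c ^ 2

theorem powerColors_one_le {c C Δ : ℕ} (hC : 1 ≤ C) (hΔ : 1 ≤ Δ) :
    64 * (lengthConst c * (Δ + 1) ^ 1) ^ 2 ≤ C * Δ ^ 2 * classCount c := by
  have hdegree : (Δ + 1) ^ 2 ≤ 4 * Δ ^ 2 := by nlinarith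
  calc 64 * (lengthConst c * (Δ + 1) ^ 1) ^ 2
      = 64 * (lengthConst c ^ 2 * (Δ + 1) ^ 2) := by rw [pow_one, mul_pow]
    _ ≤ 64 * (lengthConst c ^ 2 * (4 * Δ ^ 2)) := by gcongr
    _ = 1 * Δ ^ 2 * classCount c := by rw [classCount]; ring
    _ ≤ C * Δ ^ 2 * classCount c := by gcongr

/-- The distance within which every node finds a sink. -/
def sinkRadius (c Δ r : ℕ) : ℕ := colorBits c Δ (2 * r + 2) * (2 * r + 2) + r

/-- The number of rounds in which the labels are distributed in balls of radius `r`. -/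
noncomputable def labelRounds (c n Δ r : ℕ) : ℕ :=
  (2 * r + 2) * (logStar n + 1) + colorBits c Δ (2 * r + 2) * (2 * r + 2) + 2 * r

/-- The number of rounds of the multicoloring algorithm, when the labels are distributed in balls of
radius `r`. -/
noncomputable def roundCount (c n Δ T r : ℕ) : ℕ :=
  labelRounds c n Δ r + sinkRadius c Δ r + sinkRadius c Δ r * classCount c * (T + 2) + (2 * r + 1)

theorem logStar_succ_le_labelRounds (c n Δ r : ℕ) : logStar n + 1 ≤ labelRounds c n Δ r := by
  have hle := Nat.le_mul_of_pos_left (logStar n + 1) (2 * r + 1).succ_pos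
  rw [labelRounds, Nat.add_assoc]
  exact hle.trans (Nat.le_add_right _ _)

theorem lex_lt_iff {M x y a : ℕ} (ha : a < M) : x * M + a < y * M ↔ x < y := by
  constructor
  · exact fun h => Nat.lt_of_mul_lt_mul_right ((Nat.le_add_right _ _).trans_lt h)
  · intro h
    calc x * M + a < x * M + M := Nat.add_lt_add_left ha _
      _ = (x + 1) * M := (Nat.succ_mul x M).symm
      _ ≤ y * M := Nat.mul_le_mul_right M h

theorem isProperColoring_of_schedule {V : Type} {G : SimpleGraph V} {m M D j : ℕ} (hm : 0 < m)
    {bc lev : V → ℕ} (hbc : IsPowerColoring G 1 (m * M) bc) :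
    IsProperColoring (activeGraph G fun v => (D - lev v) * M + bc v / m = j) m
      fun v => bc v % m + 1 := by
  have hclass : ∀ v, (D - lev v) * M + bc v / m = j → bc v / m = j % M := fun v hv => by
    rw [← hv, Nat.mul_add_mod', Nat.mod_eq_of_lt (Nat.div_lt_of_lt_mul (hbc.1 v))]
  refine ⟨fun v => Finset.mem_Icc.2 ⟨Nat.le_add_left _ _, Nat.mod_lt _ hm⟩,
    fun u v huv hcol => hbc.2 u v huv.1.ne (mem_nodeBall_of_adj huv.1.symm) ?_⟩
  rw [← Nat.div_add_mod (bc u) m, hclass u huv.2.1, Nat.succ_injective hcol,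
    ← hclass v huv.2.2, Nat.div_add_mod]

section Assembly

variable {c n Δ R : ℕ} {excl : Prop}

/-- The time at which a node is colored is decided by its distance to the sinks, the farthest nodes
being the first, and then by the class of its color. -/
theorem exists_schedule {m M D : ℕ} (hm : 0 < m) {bc : NodeFun c n Δ excl ℕ} (hbc : IsLocal R bc)
    (hpower : ∀ N, IsPowerColoring N.G 1 (m * M) (bc N)) {sink : NodeFun c n Δ excl Prop}
    (hsink : IsLocal R sink) (hD : ∀ N, IsDominating N.G D (sink N)) :
    ∃ τ col : NodeFun c n Δ excl ℕ, IsLocal (R + D) τ ∧ IsLocal (R + D) col ∧ ∀ N,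
      (∀ j, IsProperColoring (activeGraph N.G fun v => τ N v = j) m (col N)) ∧
      (∀ v, τ N v < D * M ↔ ¬ sink N v) ∧
      ∀ v, ¬ sink N v → ∃ u, N.G.Adj v u ∧ τ N v < τ N u := by
  have hbc' := hbc.mono (R.le_add_right D)
  have hclass : ∀ N v, bc N v / m < M := fun N v => Nat.div_lt_of_lt_mul ((hpower N).1 v)
  refine ⟨fun N v => (D - distTo N.G (sink N) v) * M + bc N v / m, fun N v => bc N v % m + 1,
    (hsink.distTo hD).map₂ hbc' fun l b => (D - l) * M + b / m, hbc'.map fun b => b % m + 1,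
    fun N => ⟨fun j => isProperColoring_of_schedule hm (hpower N), fun v => ?_, fun v hv => ?_⟩⟩
  · have hle := (hD N).distTo_le (v := v)
    rw [lex_lt_iff (hclass N v), ← (hD N).distTo_eq_zero_iff]
    omega
  · rw [← (hD N).distTo_eq_zero_iff] at hv
    obtain ⟨u, hvu, hu⟩ := exists_adj_distTo_lt hv
    have hle := (hD N).distTo_le (v := v)
    exact ⟨u, hvu, ((lex_lt_iff (hclass N v)).2 (by omega)).trans_le (Nat.le_add_right _ _)⟩

theorem exists_coloring_of_isDominating {C T D q r : ℕ} (hC : 1 ≤ C) (hΔ : 3 ≤ Δ) (hq : 2 ≤ q)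
    (hexcl : Δ + 2 ≤ q → excl) (hr : 4 * Nat.clog Δ q ≤ r)
    (hA : ListColoringInTime c (C * Δ ^ 2) n Δ T) (hR : logStar n + 1 ≤ R)
    {dead poor : NodeFun c n Δ excl Prop} (hdead : IsLocal R dead) (hpoor : IsLocal R poor)
    (hsep : ∀ N, IsSeparated N.G (2 * r + 1) (poor N))
    (hsmall : ∀ N v, poor N v → (nodeBall N.G r v).ncard < q)
    (hD : ∀ N, IsDominating N.G D fun v => dead N v ∨ poor N v) :
    ∃ g : NodeFun c n Δ excl ℕ, IsLocal (R + D + D * classCount c * (T + 2) + (2 * r + 1)) g ∧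
      ∀ N, IsProperColoring (activeGraph N.G fun v => ¬ dead N v) Δ (g N) := by
  have hsink : IsLocal R fun N v => dead N v ∨ poor N v := hdead.map₂ hpoor Or
  obtain ⟨bc, hbc, hpower⟩ := exists_powerColoring (c := c) (n := n) (Δ := Δ) (excl := excl) 1
  obtain ⟨τ, col, hτ, hcol, hschedule⟩ := exists_schedule (m := C * Δ ^ 2) (by positivity)
    (hbc.mono (by omega)) (fun N => (hpower N).mono (powerColors_one_le hC (by omega))) hsink hD
  obtain ⟨f, hf, hfproper⟩ := exists_scheduledColoring (J := D * classCount c) (by omega) hA hτ hcol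
    (fun N => (hschedule N).1) fun N v hv => (hschedule N).2.2 v (((hschedule N).2.1 v).1 hv)
  simp only [fun N v => (hschedule N).2.1 v, not_or] at hfproper
  have hle : R ≤ R + D + D * classCount c * (T + 2) := by
    rw [Nat.add_assoc]
    exact Nat.le_add_right _ _
  exact exists_filledColoring hΔ hq hexcl hr hf (hdead.mono hle) (hpoor.mono hle) hsep hsmall
    hfproper

theorem IsLocal.multicoloringInTime {p q : ℕ} {X : NodeFun c n Δ excl (Finset ℕ)}
    (hX : IsLocal R X) (h : ∀ N, IsMulticoloring N.G p q (X N)) :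
    MulticoloringInTime c n Δ p q excl R := by
  obtain ⟨A, hA⟩ := hX.exists_algorithm
  refine ⟨A, fun V _ G _ ident hN hfree => ?_⟩
  have hmulti := h ⟨V, G, ident, hN, hfree⟩
  rwa [← hA] at hmulti

theorem exists_labels_or_poor (q r : ℕ) :
    ∃ (lab : NodeFun c n Δ excl ℕ) (poor : NodeFun c n Δ excl Prop),
      IsLocal (labelRounds c n Δ r) lab ∧ IsLocal (labelRounds c n Δ r) poor ∧
      (∀ N, IsSeparated N.G (2 * r + 1) (poor N)) ∧
      (∀ N v, poor N v → (nodeBall N.G r v).ncard < q) ∧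
      ∀ i < q, ∀ N, IsDominating N.G (sinkRadius c Δ r) fun v => lab N v = i ∨ poor N v := by
  obtain ⟨pc, hpc, hpower⟩ :=
    exists_powerColoring (c := c) (n := n) (Δ := Δ) (excl := excl) (2 * r + 2)
  obtain ⟨Z, hZ, hruling⟩ := exists_rulingSet hpc fun N =>
    (hpower N).mono (powerColors_le_two_pow c Δ (2 * r + 2))
  obtain ⟨lab, hlab, hsurj⟩ := exists_labels (r := r) (q := q) hZ
    fun N => (hruling N).1.mono (by omega) fun _ => id
  have hr : r ≤ labelRounds c n Δ r := by
    rw [labelRounds]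
    omega
  refine ⟨lab, fun N v => Z N v ∧ (nodeBall N.G r v).ncard < q, hlab,
    (hZ.mono (Nat.le_add_right _ _)).map₂
      ((isLocal_ncard_nodeBall r).mono hr) fun z k => z ∧ k < q,
    fun N => (hruling N).1.mono (by omega) fun _ hv => hv.1, fun _ _ hv => hv.2,
    fun i hi N v => ?_⟩
  obtain ⟨u, hu, hZu⟩ := (hruling N).2 v
  obtain hsmall | hlarge := lt_or_ge (nodeBall N.G r u).ncard q
  · exact ⟨u, nodeBall_subset_nodeBall (Nat.le_add_right _ _) hu, Or.inr ⟨hZu, hsmall⟩⟩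
  · obtain ⟨w, hw, hwi⟩ := hsurj N u hZu hlarge hi
    exact ⟨w, mem_nodeBall_trans hu hw, Or.inl hwi⟩

theorem multicoloringInTime_roundCount {C T q r : ℕ} (hC : 1 ≤ C) (hΔ : 3 ≤ Δ) (hq : 2 ≤ q)
    (hexcl : Δ + 2 ≤ q → excl) (hr : 4 * Nat.clog Δ q ≤ r)
    (hA : ListColoringInTime c (C * Δ ^ 2) n Δ T) :
    MulticoloringInTime c n Δ (q * Δ) (q - 1) excl (roundCount c n Δ T r) := by
  obtain ⟨lab, poor, hlab, hpoor, hsep, hsmall, hD⟩ :=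
    exists_labels_or_poor (c := c) (n := n) (Δ := Δ) (excl := excl) q r
  have hcolor : ∀ i : ℕ, ∃ g : NodeFun c n Δ excl ℕ, IsLocal (roundCount c n Δ T r) g ∧
      (i < q → ∀ N, IsProperColoring (activeGraph N.G fun v => lab N v ≠ i) Δ (g N)) := fun i => by
    by_cases hi : i < q
    · obtain ⟨g, hg, hproper⟩ := exists_coloring_of_isDominating hC hΔ hq hexcl hr hA
        (logStar_succ_le_labelRounds c n Δ r) (hlab.map (· = i)) hpoor hsep hsmall (hD i hi)
      exact ⟨g, hg, fun _ => hproper⟩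
    · exact ⟨fun _ _ => 0, isLocal_const _ _, fun h => absurd h hi⟩
  choose g hg hproper using hcolor
  have hlab' : IsLocal (roundCount c n Δ T r) lab := hlab.mono (by rw [roundCount]; omega)
  exact IsLocal.multicoloringInTime (hlab'.map₂ (IsLocal.pi hg) fun l φ =>
    ((Finset.range q).erase l).image fun i => i * Δ + φ i) fun N =>
      isMulticoloring_blocks fun i hi => hproper i hi N

theorem multicoloringInTime_zero_of_card_le_one {p q : ℕ} (hn : n ≤ 1) (hqp : q ≤ p) :
    MulticoloringInTime c n Δ p q excl 0 := by
  refine IsLocal.multicoloringInTime (isLocal_const 0 (Finset.Icc 1 q)) fun N =>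
    ⟨fun _ => Finset.Icc_subset_Icc_right hqp, fun _ => by simp, fun u v huv => ?_⟩
  have hcard : Fintype.card N.V ≤ 1 := N.isNetwork.card_eq.trans_le hn
  exact absurd (Fintype.card_le_one_iff.1 hcard u v) huv.ne

theorem multicoloringInTime_zero (p : ℕ) : MulticoloringInTime c n Δ p 0 excl 0 :=
  IsLocal.multicoloringInTime (isLocal_const 0 ∅) fun _ =>
    ⟨fun _ => Finset.empty_subset _, fun _ => Nat.zero_le _,
      fun _ _ _ => Finset.disjoint_empty_left _⟩

theorem MulticoloringInTime.of_imp {p q : ℕ} {excl' : Prop} (h : excl → excl')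
    (hM : MulticoloringInTime c n Δ p q excl R) : MulticoloringInTime c n Δ p q excl' R := by
  obtain ⟨A, hA⟩ := hM
  exact ⟨A, fun V _ G _ ident hN hfree => hA V G ident hN fun he => hfree (h he)⟩

end Assembly

/-! ### List coloring takes at least one round -/

theorem exists_choice_eq_choice {f g : Finset ℕ → ℕ} (hf : ∀ L, 2 ≤ L.card → f L ∈ L)
    (hg : ∀ L, 2 ≤ L.card → g L ∈ L) : ∃ L L', 2 ≤ L.card ∧ 2 ≤ L'.card ∧ f L = g L' := by
  set a := f {0, 1}
  have hpair : ({a + 1, a + 2} : Finset ℕ).card = 2 := Finset.card_pair (by omega)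
  set b := f {a + 1, a + 2} with hb
  have hab : a ≠ b := by
    have hmem := hf {a + 1, a + 2} hpair.ge
    rw [← hb, Finset.mem_insert, Finset.mem_singleton] at hmem
    omega
  have hcard : 2 ≤ ({a, b} : Finset ℕ).card := (Finset.card_pair hab).ge
  have hgmem := hg {a, b} hcard
  rw [Finset.mem_insert, Finset.mem_singleton] at hgmem
  obtain h | h := hgmem
  · exact ⟨{0, 1}, {a, b}, le_rfl, hcard, h.symm⟩
  · exact ⟨{a + 1, a + 2}, {a, b}, hpair.ge, hcard, h.symm⟩

theorem degree_edge_le_one {V : Type} [Fintype V] (u v w : V)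
    [DecidableRel (SimpleGraph.edge u v).Adj] : (SimpleGraph.edge u v).degree w ≤ 1 := by
  rw [← SimpleGraph.card_neighborFinset_eq_degree]
  refine Finset.card_le_one.2 fun a ha b hb => ?_
  rw [SimpleGraph.mem_neighborFinset, SimpleGraph.edge_adj] at ha hb
  grind

theorem isNetwork_edge {c n Δ : ℕ} (hc : 1 ≤ c) (hΔ : 1 ≤ Δ) (u v : Fin n)
    [DecidableRel (SimpleGraph.edge u v).Adj] :
    IsNetwork c n Δ (SimpleGraph.edge u v) fun w => w.val + 1 where
  card_eq := Fintype.card_fin n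
  maxDegree_le := SimpleGraph.maxDegree_le_of_forall_degree_le _ _ fun w =>
    (degree_edge_le_one u v w).trans hΔ
  ident_mem w := Finset.mem_Icc.2
    ⟨Nat.le_add_left _ _, w.isLt.trans_le (Nat.le_self_pow (by omega) n)⟩
  ident_injective _ _ h := Fin.ext (Nat.succ_injective h)

/-- Without communication, each endpoint of an edge has to choose from its list blindly. -/
theorem one_le_of_listColoringInTime {c m n Δ T : ℕ} (hc : 1 ≤ c) (hm : 2 ≤ m) (hΔ : 1 ≤ Δ)
    (hn : 2 ≤ n) (h : ListColoringInTime c m n Δ T) : 1 ≤ T := by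
  classical
  refine Nat.one_le_iff_ne_zero.2 fun hT => ?_
  subst hT
  obtain ⟨A, hA⟩ := h
  let u : Fin n := ⟨0, by omega⟩
  let v : Fin n := ⟨1, by omega⟩
  have huv : u ≠ v := by simp [u, v]
  let G := SimpleGraph.edge u v
  have hcol : IsProperColoring G m fun w => if w = u then 1 else 2 := by
    refine ⟨fun w => Finset.mem_Icc.2 ?_, fun w w' hww' => ?_⟩
    · dsimp only
      split_ifs <;> omega
    · rw [SimpleGraph.edge_adj] at hww'
      grind
  have hsolve : ∀ L L' : Finset ℕ, 2 ≤ L.card → 2 ≤ L'.card →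
      let x := A.output (A.init n Δ (u.val + 1) (G.degree u) (1, L))
      let y := A.output (A.init n Δ (v.val + 1) (G.degree v) (2, L'))
      x ∈ L ∧ y ∈ L' ∧ x ≠ y := by
    intro L L' hL hL'
    have hlist := hA (Fin n) G _ _ (fun w => if w = u then L else L') (isNetwork_edge hc hΔ u v)
      hcol fun w => by
        have hdegree : G.degree w ≤ 1 := degree_edge_le_one u v w
        split_ifs <;> omega
    have hadj : G.Adj u v := (SimpleGraph.edge_adj ..).2 ⟨Or.inl ⟨rfl, rfl⟩, huv⟩
    simpa [LocalAlgorithm.run, LocalAlgorithm.stateAfter, huv.symm] using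
      And.intro (hlist.1 u) (And.intro (hlist.1 v) (hlist.2 u v hadj))
  obtain ⟨L, L', hL, hL', heq⟩ := exists_choice_eq_choice
    (fun L hL => (hsolve L L hL hL).1) fun L hL => (hsolve L L hL hL).2.1
  exact (hsolve L L' hL hL').2.2 heq

/-! ### Bounds on the number of rounds -/

theorem one_le_log_of_three_le {Δ : ℕ} (hΔ : 3 ≤ Δ) : 1 ≤ Real.log Δ := by
  rw [Real.le_log_iff_exp_le (by positivity)]
  have hexp := Real.exp_one_lt_three
  have hΔ' : (3 : ℝ) ≤ Δ := by exact_mod_cast hΔ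
  linarith

theorem clog_succ_le_log {Δ : ℕ} (hΔ : 3 ≤ Δ) : (Nat.clog 2 (Δ + 1) : ℝ) ≤ 5 * Real.log Δ := by
  have hlog : Real.log (Δ + 1 : ℕ) ≤ 2 * Real.log Δ := by
    rw [← Real.log_rpow (by positivity), Real.rpow_two]
    refine Real.log_le_log (by positivity) ?_
    norm_cast
    nlinarith
  have hlogb : Real.logb 2 (Δ + 1 : ℕ) ≤ 4 * Real.log Δ := by
    rw [Real.logb, div_le_iff₀ (Real.log_pos one_lt_two)]
    nlinarith [Real.log_two_gt_d9, one_le_log_of_three_le hΔ]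
  linarith [cast_clog_two_le Δ.succ_pos, one_le_log_of_three_le hΔ]

/-- The constant in the bound on `colorBits`, where `106 = 6 + 2 * 10 * 5`. -/
noncomputable def bitsConst (c : ℕ) : ℝ := 106 + 2 * Nat.clog 2 (lengthConst c)

/-- The constant in the bound on the number of rounds. -/
noncomputable def roundConst (c : ℕ) : ℝ :=
  41 + 20 * bitsConst c + 3 * classCount c * (10 * bitsConst c + 4)

theorem bitsConst_nonneg (c : ℕ) : 0 ≤ bitsConst c := by
  rw [bitsConst]
  positivity

theorem one_le_roundConst (c : ℕ) : 1 ≤ roundConst c := by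
  have hbits := bitsConst_nonneg c
  have hclass : 0 ≤ 3 * classCount c * (10 * bitsConst c + 4) := by positivity
  rw [roundConst]
  linarith

section RoundCount

variable {c n Δ T a : ℕ}

theorem colorBits_le (hΔ : 3 ≤ Δ) (ha : 1 ≤ a) :
    (colorBits c Δ (2 * (4 * a) + 2) : ℝ) ≤ bitsConst c * (a * Real.log Δ) := by
  have ha' : (1 : ℝ) ≤ a := by exact_mod_cast ha
  have hal : 1 ≤ a * Real.log Δ := one_le_mul_of_one_le_of_one_le ha' (one_le_log_of_three_le hΔ)
  have hdegree : (2 * (2 * (4 * a) + 2)) * (Nat.clog 2 (Δ + 1) : ℝ) ≤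
      (20 * a) * (5 * Real.log Δ) := by
    gcongr ?_ * ?_
    · linarith
    · exact clog_succ_le_log hΔ
  have hconst : (6 + 2 * Nat.clog 2 (lengthConst c) : ℝ) ≤
      (6 + 2 * Nat.clog 2 (lengthConst c)) * (a * Real.log Δ) :=
    le_mul_of_one_le_right (by positivity) hal
  rw [colorBits, bitsConst]
  push_cast
  linarith

theorem colorBits_mul_le (hΔ : 3 ≤ Δ) (ha : 1 ≤ a) :
    (colorBits c Δ (2 * (4 * a) + 2) : ℝ) * (2 * (4 * a) + 2) ≤
      10 * bitsConst c * (a ^ 2 * Real.log Δ) := by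
  have ha' : (1 : ℝ) ≤ a := by exact_mod_cast ha
  have hl := one_le_log_of_three_le hΔ
  have hB := bitsConst_nonneg c
  calc (colorBits c Δ (2 * (4 * a) + 2) : ℝ) * (2 * (4 * a) + 2)
      ≤ bitsConst c * (a * Real.log Δ) * (10 * a) := by
        gcongr
        · exact colorBits_le hΔ ha
        · linarith
    _ = 10 * bitsConst c * (a ^ 2 * Real.log Δ) := by ring

theorem le_sq_mul_log (hΔ : 3 ≤ Δ) (ha : 1 ≤ a) : (a : ℝ) ≤ a ^ 2 * Real.log Δ := by
  have ha' : (1 : ℝ) ≤ a := by exact_mod_cast ha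
  rw [pow_two, mul_assoc]
  exact le_mul_of_one_le_right (Nat.cast_nonneg a)
    (one_le_mul_of_one_le_of_one_le ha' (one_le_log_of_three_le hΔ))

theorem sinkRadius_le (hΔ : 3 ≤ Δ) (ha : 1 ≤ a) :
    (sinkRadius c Δ (4 * a) : ℝ) ≤ (10 * bitsConst c + 4) * (a ^ 2 * Real.log Δ) := by
  rw [sinkRadius]
  push_cast
  linarith [colorBits_mul_le (c := c) hΔ ha, le_sq_mul_log hΔ ha]

theorem labelRounds_le (hΔ : 3 ≤ Δ) (hn : 1 ≤ logStar n) (ha : 1 ≤ a) :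
    (labelRounds c n Δ (4 * a) : ℝ) ≤
      20 * (a * logStar n) + (10 * bitsConst c + 8) * (a ^ 2 * Real.log Δ) := by
  have ha' : (1 : ℝ) ≤ a := by exact_mod_cast ha
  have hn' : (1 : ℝ) ≤ logStar n := by exact_mod_cast hn
  have hcolor : (2 * (4 * a) + 2) * (logStar n + 1 : ℝ) ≤ (10 * a) * (2 * logStar n) := by
    gcongr <;> linarith
  rw [labelRounds]
  push_cast
  linarith [colorBits_mul_le (c := c) hΔ ha, le_sq_mul_log hΔ ha]

theorem roundCount_le (hΔ : 3 ≤ Δ) (hT : 1 ≤ T) (hn : 1 ≤ logStar n) (ha : 1 ≤ a) :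
    (roundCount c n Δ T (4 * a) : ℝ) ≤
      roundConst c * ((a : ℝ) ^ 2 * Real.log Δ * T + a * logStar n) := by
  have ha' : (1 : ℝ) ≤ a := by exact_mod_cast ha
  have hT' : (1 : ℝ) ≤ T := by exact_mod_cast hT
  have hl := one_le_log_of_three_le hΔ
  have hB := bitsConst_nonneg c
  set B := bitsConst c
  set M : ℝ := (classCount c : ℝ)
  set W : ℝ := (a : ℝ) ^ 2 * Real.log Δ
  have hW : (a : ℝ) ≤ W := le_sq_mul_log hΔ ha
  have hschedule : (sinkRadius c Δ (4 * a) : ℝ) * M * (T + 2) ≤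
      (10 * B + 4) * W * M * (3 * T) := by
    gcongr
    · exact sinkRadius_le hΔ ha
    · linarith
  have htotal : (roundCount c n Δ T (4 * a) : ℝ) ≤
      20 * (a * logStar n) + (20 * B + 21) * W + 3 * M * (10 * B + 4) * (W * T) := by
    rw [roundCount]
    push_cast
    linarith [labelRounds_le (c := c) hΔ hn ha, sinkRadius_le (c := c) hΔ ha]
  have hWT : (20 * B + 21) * W ≤ (20 * B + 21) * (W * T) :=
    mul_le_mul_of_nonneg_left (le_mul_of_one_le_right (by linarith) hT') (by linarith)
  have hrest : 0 ≤ 20 * (W * T) + (20 * B + 21 + 3 * M * (10 * B + 4)) * (a * logStar n) := by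
    positivity
  rw [roundConst]
  linarith

end RoundCount

theorem exists_multicoloringInTime {c C n Δ T q : ℕ} (hc : 1 ≤ c) (hC : 1 ≤ C) (hΔ : 3 ≤ Δ)
    (hA : ListColoringInTime c (C * Δ ^ 2) n Δ T) (hq : 0 < q) : ∃ R : ℕ,
      (R : ℝ) ≤ roundConst c * ((1 + Real.logb Δ q) ^ 2 * Real.log Δ * T
        + (1 + Real.logb Δ q) * logStar n) ∧
      MulticoloringInTime c n Δ (q * Δ) (q - 1) (Δ + 2 ≤ q) R := by
  have hlogb : 0 ≤ Real.logb Δ q := Real.logb_nonneg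
    (by exact_mod_cast (show 1 < Δ by omega)) (by exact_mod_cast hq)
  have : 0 ≤ Real.log Δ := Real.log_natCast_nonneg Δ
  have hK := zero_le_one.trans (one_le_roundConst c)
  have hbound : 0 ≤ roundConst c * ((1 + Real.logb Δ q) ^ 2 * Real.log Δ * T
      + (1 + Real.logb Δ q) * logStar n) := by positivity
  obtain hn | hn := Nat.lt_or_ge 1 n
  swap
  · exact ⟨0, by rwa [Nat.cast_zero], multicoloringInTime_zero_of_card_le_one hn
      ((Nat.sub_le q 1).trans (Nat.le_mul_of_pos_right q (by omega)))⟩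
  obtain rfl | hq1 := (show 1 ≤ q from hq).eq_or_lt
  · exact ⟨0, by rwa [Nat.cast_zero], multicoloringInTime_zero _⟩
  have hT : 1 ≤ T := one_le_of_listColoringInTime hc (by nlinarith) (by omega) hn hA
  have ha : (Nat.clog Δ q : ℝ) ≤ 1 + Real.logb Δ q := by
    rw [← Real.natCeil_logb_natCast, add_comm]
    exact (Nat.ceil_lt_add_one hlogb).le
  refine ⟨roundCount c n Δ T (4 * Nat.clog Δ q), ?_,
    multicoloringInTime_roundCount hC hΔ hq1 id le_rfl hA⟩
  refine (roundCount_le hΔ hT (logStar_pos hn) (Nat.clog_pos (by omega) hq1)).trans ?_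
  gcongr

section Support

variable {n Δ : ℕ} {ε : ℝ}

theorem cast_natCeil_succ_le {x : ℝ} (hx : 1 ≤ x) : ((⌈x⌉₊ + 1 : ℕ) : ℝ) ≤ 3 * x := by
  push_cast
  linarith [Nat.ceil_lt_add_one (zero_le_one.trans hx)]

theorem support_le (hε : 0 < ε) (hεΔ : ε ≤ Δ) :
    (((⌈(Δ : ℝ) / ε⌉₊ + 1) * Δ : ℕ) : ℝ) ≤ 3 * (Δ ^ 2 / ε) :=
  calc (((⌈(Δ : ℝ) / ε⌉₊ + 1) * Δ : ℕ) : ℝ) ≤ 3 * (Δ / ε) * Δ := by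
        rw [Nat.cast_mul]
        gcongr
        exact cast_natCeil_succ_le ((one_le_div hε).2 hεΔ)
    _ = 3 * (Δ ^ 2 / ε) := by ring

theorem support_div_le (hΔ : 0 < Δ) (hε : 0 < ε) :
    (((⌈(Δ : ℝ) / ε⌉₊ + 1) * Δ : ℕ) : ℝ) / ((⌈(Δ : ℝ) / ε⌉₊ + 1 - 1 : ℕ) : ℝ) ≤ Δ + ε := by
  have hpos : (0 : ℝ) < ⌈(Δ : ℝ) / ε⌉₊ := by
    exact_mod_cast Nat.ceil_pos.2 (div_pos (Nat.cast_pos.2 hΔ) hε)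
  have hceil := (div_le_iff₀ hε).1 (Nat.le_ceil ((Δ : ℝ) / ε))
  rw [Nat.add_sub_cancel, div_le_iff₀ hpos]
  push_cast
  linarith

theorem lt_one_of_add_two_le (h : Δ + 2 ≤ ⌈(Δ : ℝ) / ε⌉₊ + 1) : ε < 1 := by
  by_contra! hε
  have hceil : ⌈(Δ : ℝ) / ε⌉₊ ≤ Δ := Nat.ceil_le.2 (div_le_self (Nat.cast_nonneg Δ) hε)
  omega

theorem one_add_logb_le {q : ℕ} (hΔ : 3 ≤ Δ) (hε : 0 < ε) (hq0 : 0 < q)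
    (hq : (q : ℝ) ≤ 3 * (Δ / ε)) :
    1 + Real.logb Δ q ≤ 3 * (1 + Real.posLog (1 / ε) / Real.log Δ) := by
  have hΔ' : (3 : ℝ) ≤ Δ := by exact_mod_cast hΔ
  have hl : 0 < Real.log Δ := Real.log_pos (by linarith)
  have hlog : Real.log q ≤ 2 * Real.log Δ + Real.posLog (1 / ε) :=
    calc Real.log q ≤ Real.log (3 * (Δ * (1 / ε))) :=
          Real.log_le_log (Nat.cast_pos.2 hq0) (by rwa [mul_one_div])
      _ = Real.log 3 + (Real.log Δ + Real.log (1 / ε)) := by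
          rw [Real.log_mul (by norm_num) (by positivity),
            Real.log_mul (by positivity) (by positivity)]
      _ ≤ Real.log Δ + (Real.log Δ + Real.posLog (1 / ε)) := by
          gcongr
          exact le_max_right _ _
      _ = 2 * Real.log Δ + Real.posLog (1 / ε) := by ring
  have hlogb : Real.logb Δ q ≤ 2 + Real.posLog (1 / ε) / Real.log Δ := by
    rw [Real.logb, div_le_iff₀ hl, add_mul, div_mul_cancel₀ _ hl.ne']
    exact hlog
  have hpos : 0 ≤ Real.posLog (1 / ε) / Real.log Δ := div_nonneg Real.posLog_nonneg hl.le
  linarith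

theorem sq_mul_le {l p α : ℝ} (hl : 0 < l) (hα0 : 0 ≤ α) (hα : α ≤ 3 * (1 + p / l)) :
    α ^ 2 * l ≤ 18 * (l + p ^ 2 / l) :=
  calc α ^ 2 * l ≤ (3 * (1 + p / l)) ^ 2 * l := by gcongr
    _ ≤ 18 * (1 + (p / l) ^ 2) * l := by
        gcongr
        nlinarith [sq_nonneg (1 - p / l)]
    _ = 18 * (l + p ^ 2 / l) := by field_simp

theorem rounds_le_of_cast_le {q T : ℕ} (hΔ : 3 ≤ Δ) (hε : 0 < ε) (hq0 : 0 < q)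
    (hq : (q : ℝ) ≤ 3 * (Δ / ε)) :
    (1 + Real.logb Δ q) ^ 2 * Real.log Δ * T + (1 + Real.logb Δ q) * logStar n ≤
      18 * ((Real.log Δ + Real.posLog (1 / ε) ^ 2 / Real.log Δ) * T
        + (1 + Real.posLog (1 / ε) / Real.log Δ) * logStar n) := by
  have hΔ1 : (1 : ℝ) < Δ := by exact_mod_cast (show 1 < Δ by omega)
  have hα0 : 0 ≤ 1 + Real.logb Δ q :=
    add_nonneg zero_le_one (Real.logb_nonneg hΔ1 (by exact_mod_cast hq0))
  have hα := one_add_logb_le hΔ hε hq0 hq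
  rw [mul_add, ← mul_assoc 18, ← mul_assoc 18]
  gcongr ?_ * _ + ?_ * _
  · exact sq_mul_le (Real.log_pos hΔ1) hα0 hα
  · linarith

end Support

theorem mainTheorem2 (c C : ℕ) (hc : 1 ≤ c) (hC : 1 ≤ C) :
    ∃ K : ℝ, 0 < K ∧ ∀ n Δ T : ℕ, 3 ≤ Δ → ListColoringInTime c (C * Δ ^ 2) n Δ T →
      (∀ q : ℕ, 0 < q → ∃ R : ℕ,
        (R : ℝ) ≤ K * ((1 + Real.logb Δ q) ^ 2 * Real.log Δ * T
          + (1 + Real.logb Δ q) * logStar n) ∧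
        MulticoloringInTime c n Δ (q * Δ) (q - 1) (Δ + 2 ≤ q) R) ∧
      (∀ ε : ℝ, 0 < ε → ε ≤ Δ → ∃ q R : ℕ, 2 ≤ q ∧
        (Δ : ℝ) / ε ≤ q ∧ (q : ℝ) ≤ K * (Δ / ε) ∧
        ((q * Δ : ℕ) : ℝ) / ((q - 1 : ℕ) : ℝ) ≤ Δ + ε ∧
        ((q * Δ : ℕ) : ℝ) ≤ K * (Δ ^ 2 / ε) ∧
        (R : ℝ) ≤ K * ((Real.log Δ + Real.posLog (1 / ε) ^ 2 / Real.log Δ) * T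
          + (1 + Real.posLog (1 / ε) / Real.log Δ) * logStar n) ∧
        MulticoloringInTime c n Δ (q * Δ) (q - 1) (ε < 1) R) := by
  have hK := one_le_roundConst c
  refine ⟨18 * roundConst c, by linarith, fun n Δ T hΔ hA => ⟨fun q hq => ?_, fun ε hε hεΔ => ?_⟩⟩
  · obtain ⟨R, hR, hM⟩ := exists_multicoloringInTime hc hC hΔ hA hq
    have hlogb : 0 ≤ Real.logb Δ q := Real.logb_nonneg
      (by exact_mod_cast (show 1 < Δ by omega)) (by exact_mod_cast hq)
    exact ⟨R, hR.trans (mul_le_mul_of_nonneg_right (by linarith) (by positivity)), hM⟩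
  have hq := cast_natCeil_succ_le ((one_le_div hε).2 hεΔ)
  have h3K : ∀ {y : ℝ}, 0 ≤ y → 3 * y ≤ 18 * roundConst c * y :=
    mul_le_mul_of_nonneg_right (by linarith)
  obtain ⟨R, hR, hM⟩ := exists_multicoloringInTime hc hC hΔ hA (Nat.succ_pos ⌈(Δ : ℝ) / ε⌉₊)
  refine ⟨⌈(Δ : ℝ) / ε⌉₊ + 1, R, Nat.succ_le_succ (Nat.ceil_pos.2 (by positivity)),
    (Nat.le_ceil _).trans (by simp), hq.trans (h3K (by positivity)), support_div_le (by omega) hε,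
    (support_le hε hεΔ).trans (h3K (by positivity)), hR.trans ?_, hM.of_imp lt_one_of_add_two_le⟩
  calc _ ≤ roundConst c * (18 * _) := mul_le_mul_of_nonneg_left
        (rounds_le_of_cast_le hΔ hε (Nat.succ_pos _) hq) (by linarith)
    _ = _ := by rw [← mul_assoc, mul_comm (roundConst c)]
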